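/- Let all graphs be finite and simple. For edges $e_1,e_2$ of a graph $G$, a \emph{common edge} of $e_1$ and $e_2$ is an edge $e\in E(G)\setminus\{e_1,e_2\}$ that joins an endpoint of $e_1$ to an endpoint of $e_2$. A set $D\subseteq E(G)$ is an \emph{edge open packing} (EOP) set if no two distinct edges of $D$ have a common edge; $\rho_e^o(G)$ denotes the maximum size of an EOP set of $G$. A \emph{proper interval graph} is the intersection graph of a family of closed intervals of the real line none of which properly contains another. An ordering $v_1,\dots,v_n$ of $V(G)$ is a \emph{perfect elimination ordering} if, for every $i$, the closed neighbourhood of $v_i$ in $G[v_i,\dots,v_n]$ is a clique, and a \emph{bi-compatible elimination ordering} (BCO) if both it and its reverse are perfect elimination orderings. Given an ordering, put $l(i)=\max(\{i\}\cup\{r>i: v_iv_r\in E(G)\})$. **Theorem.** 1. A maximum EOP set can be computed in polynomial time on proper interval graphs: there are a (deterministic, unit-cost) random-access machine program, with addition and truncated subtraction as its arithmetic operations, and a polynomial $p$ such that for every proper interval graph $G$ on the vertex set $\{0,\dots,n-1\}$, connected or not, the program, given $n$ and the adjacency matrix of $G$ as a word of length $N=n^2+1$, halts after at most $p(N)$ steps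 and outputs a list without repetitions of the edges of an EOP set of $G$ of maximum size $\rho_e^o(G)$. 2. Let $G$ be a connected proper interval graph with a BCO $v_1,\dots,v_n$, $n\ge 1$, and put $k=l(1)$. Then $\rho_e^o(G)$ is the maximum of the following numbers: * $1+\rho_e^o(G[v_{l(j)+1},\dots,v_n])$ for $1<j\le k$; * $2+\rho_e^o(G[v_{l(p)+1},\dots,v_n])$ for $1<j\le k$ and $k<p\le l(j)$; * $\rho_e^o(G[v_2,\dots,v_n])$. (A graph without vertices has $\rho_e^o=0$.) -/

import Mathlib

/-! ### Random-access machines with unit cost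

A program acts on registers and on a memory, both indexed by `ℕ` and holding natural numbers.
A program mentions only finitely many registers; memory is addressed indirectly.  The arithmetic
is addition and truncated subtraction (no multiplication), so the unit-cost step count is
polynomially related to the running time of a Turing machine. -/

namespace RAM

/-- A configuration of the data of the machine. -/
structure State where
  reg : ℕ → ℕ
  mem : ℕ → ℕ

/-- Programs, in structured form. -/
inductive Prog where
  /-- `R_r := c` -/
  | const (r c : ℕ)
  /-- `R_r := R_a + R_b` -/
  | add (r a b : ℕ)
  /-- `R_r := max (R_a - R_b) 0` -/
  | sub (r a b : ℕ)
  /-- `R_r := M[R_a]` -/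
  | load (r a : ℕ)
  /-- `M[R_a] := R_r` -/
  | store (a r : ℕ)
  /-- `P; Q` -/
  | seq (P Q : Prog)
  /-- `if R_a < R_b then P else Q` -/
  | ite (a b : ℕ) (P Q : Prog)
  /-- `while R_a < R_b do P` -/
  | loop (a b : ℕ) (P : Prog)

/-- `s.setReg r x` is `s` with the register `R_r` overwritten by `x`. -/
def State.setReg (s : State) (r x : ℕ) : State := ⟨Function.update s.reg r x, s.mem⟩

/-- `s.setMem a x` is `s` with the memory cell `M[a]` overwritten by `x`. -/
def State.setMem (s : State) (a x : ℕ) : State := ⟨s.reg, Function.update s.mem a x⟩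

/-- `Exec P s t s'`: started in `s`, the program `P` halts in the state `s'` after exactly `t`
steps, where every assignment, load, store and every evaluation of a test is one step. -/
inductive Exec : Prog → State → ℕ → State → Prop where
  | const (s : State) (r c : ℕ) : Exec (.const r c) s 1 (s.setReg r c)
  | add (s : State) (r a b : ℕ) : Exec (.add r a b) s 1 (s.setReg r (s.reg a + s.reg b))
  | sub (s : State) (r a b : ℕ) : Exec (.sub r a b) s 1 (s.setReg r (s.reg a - s.reg b))
  | load (s : State) (r a : ℕ) : Exec (.load r a) s 1 (s.setReg r (s.mem (s.reg a)))
  | store (s : State) (a r : ℕ) : Exec (.store a r) s 1 (s.setMem (s.reg a) (s.reg r))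
  | seq {P Q : Prog} {s s' s'' : State} {t t' : ℕ} :
      Exec P s t s' → Exec Q s' t' s'' → Exec (.seq P Q) s (t + t') s''
  | ite_true {a b : ℕ} {P Q : Prog} {s s' : State} {t : ℕ} :
      s.reg a < s.reg b → Exec P s t s' → Exec (.ite a b P Q) s (1 + t) s'
  | ite_false {a b : ℕ} {P Q : Prog} {s s' : State} {t : ℕ} :
      ¬ s.reg a < s.reg b → Exec Q s t s' → Exec (.ite a b P Q) s (1 + t) s'
  | loop_true {a b : ℕ} {P : Prog} {s s' s'' : State} {t t' : ℕ} :
      s.reg a < s.reg b → Exec P s t s' → Exec (.loop a b P) s' t' s'' →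
        Exec (.loop a b P) s (1 + t + t') s''
  | loop_false {a b : ℕ} {P : Prog} {s : State} :
      ¬ s.reg a < s.reg b → Exec (.loop a b P) s 1 s

/-- The machine is deterministic: the step count and the final state are unique. -/
theorem Exec.det {P : Prog} {s s₁ s₂ : State} {t₁ t₂ : ℕ}
    (h₁ : Exec P s t₁ s₁) (h₂ : Exec P s t₂ s₂) : t₁ = t₂ ∧ s₁ = s₂ := by
  induction h₁ generalizing t₂ s₂ with
  | const | add | sub | load | store => cases h₂; exact ⟨rfl, rfl⟩
  | seq _ _ ih ih' =>
    cases h₂ with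
    | seq k k' =>
      obtain ⟨rfl, rfl⟩ := ih k
      obtain ⟨rfl, rfl⟩ := ih' k'
      exact ⟨rfl, rfl⟩
  | ite_true h _ ih =>
    cases h₂ with
    | ite_true _ k => obtain ⟨rfl, rfl⟩ := ih k; exact ⟨rfl, rfl⟩
    | ite_false h' _ => exact absurd h h'
  | ite_false h _ ih =>
    cases h₂ with
    | ite_true h' _ => exact absurd h' h
    | ite_false _ k => obtain ⟨rfl, rfl⟩ := ih k; exact ⟨rfl, rfl⟩
  | loop_true h _ _ ih ih' =>
    cases h₂ with
    | loop_true _ k k' =>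
      obtain ⟨rfl, rfl⟩ := ih k
      obtain ⟨rfl, rfl⟩ := ih' k'
      exact ⟨rfl, rfl⟩
    | loop_false h' => exact absurd h h'
  | loop_false h =>
    cases h₂ with
    | loop_true h' _ _ => exact absurd h' h
    | loop_false _ => exact ⟨rfl, rfl⟩

/-- The initial state on the input word `x`: `R_0` holds its length, `M[0], M[1], …` hold its
entries, and everything else is `0`. -/
def init (x : List ℕ) : State where
  reg := fun r => if r = 0 then x.length else 0
  mem := fun i => x.getD i 0

/-- On the input word `x` the program `P` halts after exactly `t` steps with output word `y`:
at the end `R_0` holds the length of `y` and `M[0], M[1], …` hold its entries. -/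
def OutputsIn (P : Prog) (x y : List ℕ) (t : ℕ) : Prop :=
  ∃ s : State, Exec P (init x) t s ∧ s.reg 0 = y.length ∧
    ∀ (i : ℕ) (h : i < y.length), s.mem i = y[i]

end RAM

namespace EdgeOpenPacking

/-! ### Edge open packing sets -/

/-- `e` is a common edge of `e₁` and `e₂`: it is an edge of `G` other than these two that joins
an endpoint of `e₁` to an endpoint of `e₂`. -/
def IsCommonEdge {V : Type*} (G : SimpleGraph V) (e₁ e₂ e : Sym2 V) : Prop :=
  e ∈ G.edgeSet ∧ e ≠ e₁ ∧ e ≠ e₂ ∧ ∃ x ∈ e₁, ∃ y ∈ e₂, e = s(x, y)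

/-- `D` is an edge open packing (EOP) set of `G`. -/
def IsEOP {V : Type*} (G : SimpleGraph V) (D : Finset (Sym2 V)) : Prop :=
  (D : Set (Sym2 V)) ⊆ G.edgeSet ∧
    ∀ e₁ ∈ D, ∀ e₂ ∈ D, e₁ ≠ e₂ → ¬ ∃ e, IsCommonEdge G e₁ e₂ e

/-- `D` is an EOP set of `G` of maximum size. -/
def IsMaximumEOP {V : Type*} (G : SimpleGraph V) (D : Finset (Sym2 V)) : Prop :=
  IsEOP G D ∧ ∀ D' : Finset (Sym2 V), IsEOP G D' → D'.card ≤ D.card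

/-- The edge open packing number of a finite graph. -/
noncomputable def eopNumber {V : Type*} [Finite V] (G : SimpleGraph V) : ℕ :=
  sSup {m : ℕ | ∃ D : Finset (Sym2 V), IsEOP G D ∧ D.card = m}

/-! ### Proper interval graphs and bi-compatible elimination orderings -/

/-- `G` is the intersection graph of a family of closed intervals `[a v, b v]` of the real line
none of which properly contains another. -/
def IsProperIntervalGraph {V : Type*} (G : SimpleGraph V) : Prop :=
  ∃ a b : V → ℝ, (∀ v, a v ≤ b v) ∧
    (∀ u w, G.Adj u w ↔
      u ≠ w ∧ (Set.Icc (a u) (b u) ∩ Set.Icc (a w) (b w)).Nonempty) ∧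
    ∀ u w, ¬ Set.Icc (a u) (b u) ⊂ Set.Icc (a w) (b w)

/-- The closed neighbourhood of `v` is a clique. -/
def IsSimplicial {V : Type*} (G : SimpleGraph V) (v : V) : Prop :=
  G.IsClique (insert v (G.neighborSet v))

/-- `σ 0, σ 1, …` is a perfect elimination ordering: each `σ i` is a simplicial vertex of the
subgraph induced by `σ i, σ (i + 1), …`. -/
def IsPEO {V : Type*} {n : ℕ} (G : SimpleGraph V) (σ : Fin n ≃ V) : Prop :=
  ∀ i : Fin n, IsSimplicial (G.induce {v | i ≤ σ.symm v}) ⟨σ i, by simp⟩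

/-- `σ` is a bi-compatible elimination ordering: `σ` and the reverse ordering are perfect
elimination orderings. -/
def IsBCO {V : Type*} {n : ℕ} (G : SimpleGraph V) (σ : Fin n ≃ V) : Prop :=
  IsPEO G σ ∧ IsPEO G (Fin.revPerm.trans σ)

open Classical in
/-- The largest position among `i` itself and the positions `r > i` of neighbours of `σ i`. -/
noncomputable def lastNbr {V : Type*} {n : ℕ} (G : SimpleGraph V) (σ : Fin n ≃ V)
    (i : Fin n) : Fin n :=
  (Finset.univ.filter fun r => r = i ∨ (i < r ∧ G.Adj (σ i) (σ r))).max' ⟨i, by simp⟩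

/-- The subgraph induced by the vertices at the positions after `m`. -/
def suffixAfter {V : Type*} {n : ℕ} (G : SimpleGraph V) (σ : Fin n ≃ V) (m : Fin n) :
    SimpleGraph {v : V | m < σ.symm v} :=
  G.induce {v : V | m < σ.symm v}

/-! ### Encodings of inputs and outputs -/

open Classical in
/-- The number of vertices followed by the adjacency matrix, row by row. -/
noncomputable def encodeGraph {n : ℕ} (G : SimpleGraph (Fin n)) : List ℕ :=
  n :: List.ofFn fun k : Fin (n * n) => if G.Adj k.divNat k.modNat then 1 else 0

/-- The word `y = u₁ w₁ u₂ w₂ …` lists the edges `u₁w₁, u₂w₂, …` of `D`, each exactly once. -/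
def ListsEdges {n : ℕ} (y : List ℕ) (D : Finset (Sym2 (Fin n))) : Prop :=
  ∃ L : List (Fin n × Fin n),
    y = L.flatMap (fun e => [(e.1 : ℕ), (e.2 : ℕ)]) ∧
    (L.map fun e => s(e.1, e.2)).Nodup ∧
    ∀ e : Sym2 (Fin n), e ∈ D ↔ e ∈ L.map fun e => s(e.1, e.2)

end EdgeOpenPacking

/-! The recursion. Deleting a vertex that is simplicial in what remains does not separate the
others. Stripping a bi-compatible ordering from both ends therefore shows that `σ i` and `σ j` are
joined through the positions between them (`IsBCO.reflTransGen`). Hence consecutive vertices are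
adjacent, every edge spans a clique (`IsBCO.adj_of_le`), and `lastNbr` is monotone. In a maximum
packing the first vertex lies on at most one edge, and its component is that edge or a path with two
edges. All positions up to the last neighbour of the component's last vertex are near the component,
so the other edges lie beyond them (`card_le_of_isolated`). Conversely such a component can be added
to any packing beyond (`IsBCO.card_add_le`).

The algorithm uses neither the recursion nor an ordering. Proper interval graphs have no claws, so
the components of an EOP set are induced paths with one or two edges, and EOP sets amount to sets of
pairwise non-conflicting paths (`Indep.isEOP`, `IsEOP.exists_indep`). What is sought is a maximum
weight independent set in the conflict graph of at most `n ^ 3` paths. In an interval model the path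
that ends first is simplicial in this graph (`IsIntervalModel.exists_simplicial`), so the local
ratio method applies: find a simplicial path of positive weight, subtract its weight from every path
in conflict with it, and stack it; when no weight is left, unwinding the stack greedily gives an
optimum (`LocalRatio.cons`, `LocalRatio.optimal`). Simplicial paths are found by brute force on the
adjacency matrix; intervals occur only in the proof.

Polynomial time comes from the combinators `EComp`, `PComp` and `CComp`, all of whose loops make
exactly `n` passes. -/

namespace RAM

/-! ### Programs whose loops run over `0, …, n - 1`

The register `R_0` holds `n` and `R_1` holds `1` throughout; the other registers are used for the
values of variables and for intermediate results. -/

/-- Bind a new variable `0` in an environment, shifting the others. -/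
def push (k : ℕ) (v : ℕ → ℕ) : ℕ → ℕ
  | 0 => k
  | i + 1 => v i

/-- `f` is computed in polynomial time from `n`, an environment and the memory. -/
def EComp (f : ℕ → (ℕ → ℕ) → (ℕ → ℕ) → ℕ) : Prop :=
  -- Variable `i` lives in register `r i`, and the registers from `d` on are scratch. The bound
  -- depends on `n` alone, not on the contents of the memory, so it survives iteration.
  ∃ T : Polynomial ℕ, ∀ (r : ℕ → ℕ) (d : ℕ), 2 ≤ d → (∀ i, r i < d) →
    ∃ P : Prog, ∀ s : State, s.reg 1 = 1 → ∃ t s', Exec P s t s' ∧ t ≤ T.eval (s.reg 0) ∧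
      s'.mem = s.mem ∧ (∀ i < d, s'.reg i = s.reg i) ∧
      s'.reg d = f (s.reg 0) (fun i => s.reg (r i)) s.mem

/-- The truth value of `φ` is computed in polynomial time. -/
def PComp (φ : ℕ → (ℕ → ℕ) → (ℕ → ℕ) → Prop) : Prop :=
  ∃ f, EComp f ∧ ∀ n v m, 0 < f n v m ↔ φ n v m

/-- The transformation `C` of the memory is computed in polynomial time. -/
def CComp (C : ℕ → (ℕ → ℕ) → (ℕ → ℕ) → (ℕ → ℕ)) : Prop :=
  ∃ T : Polynomial ℕ, ∀ (r : ℕ → ℕ) (d : ℕ), 2 ≤ d → (∀ i, r i < d) →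
    ∃ P : Prog, ∀ s : State, s.reg 1 = 1 → ∃ t s', Exec P s t s' ∧ t ≤ T.eval (s.reg 0) ∧
      (∀ i < d, s'.reg i = s.reg i) ∧
      s'.mem = C (s.reg 0) (fun i => s.reg (r i)) s.mem

@[simp] theorem State.setReg_reg_self (s : State) (r x : ℕ) : (s.setReg r x).reg r = x := by
  simp [State.setReg]

theorem State.setReg_reg_of_ne (s : State) {r i : ℕ} (x : ℕ) (h : i ≠ r) :
    (s.setReg r x).reg i = s.reg i := by
  simp [State.setReg, h]

@[simp] theorem State.setReg_mem (s : State) (r x : ℕ) : (s.setReg r x).mem = s.mem := rfl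

@[simp] theorem State.setMem_reg (s : State) (a x : ℕ) : (s.setMem a x).reg = s.reg := rfl

@[simp] theorem State.setMem_mem (s : State) (a x : ℕ) :
    (s.setMem a x).mem = Function.update s.mem a x := rfl

/-- A counting loop terminates and establishes its invariant. -/
theorem Exec.exists_loop {B : Prog} {c n τ : ℕ} (I : ℕ → State → Prop)
    (hI : ∀ k s, I k s → s.reg c = k ∧ s.reg 0 = n)
    (hB : ∀ k < n, ∀ s, I k s → ∃ t s', Exec B s t s' ∧ t ≤ τ ∧ I (k + 1) s')
    {s : State} (hs : I 0 s) :
    ∃ t s', Exec (.loop c 0 B) s t s' ∧ t ≤ n * (τ + 1) + 1 ∧ I n s' := by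
  suffices H : ∀ j k s, j + k = n → I k s →
      ∃ t s', Exec (.loop c 0 B) s t s' ∧ t ≤ j * (τ + 1) + 1 ∧ I n s' from
    H n 0 s (by simp) hs
  intro j
  induction j with
  | zero =>
    intro k s hk hs
    obtain rfl : k = n := by omega
    have := hI _ _ hs
    exact ⟨1, s, .loop_false (by omega), by simp, hs⟩
  | succ j ih =>
    intro k s hk hs
    have := hI _ _ hs
    obtain ⟨t, s', h, ht, hs'⟩ := hB k (by omega) s hs
    obtain ⟨t', s'', h', ht', hs''⟩ := ih (k + 1) s' (by omega) hs'
    refine ⟨_, s'', .loop_true (by omega) h h', ?_, hs''⟩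
    rw [Nat.succ_mul]
    omega

/-! ### Computable expressions -/

theorem EComp.var (i : ℕ) : EComp fun _ v _ => v i := by
  -- There is no move instruction; a register is copied by adding it to `0`.
  refine ⟨Polynomial.C 2, fun r d hd hr => ⟨.seq (.const d 0) (.add d d (r i)), fun s hs => ?_⟩⟩
  refine ⟨_, _, .seq (.const ..) (.add ..), by simp, by simp, fun i hi => ?_, ?_⟩
  · rw [State.setReg_reg_of_ne _ _ hi.ne, State.setReg_reg_of_ne _ _ hi.ne]
  · simp [State.setReg_reg_of_ne _ _ (hr i).ne]

theorem EComp.size : EComp fun n _ _ => n := by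
  refine ⟨Polynomial.C 2, fun r d hd hr => ⟨.seq (.const d 0) (.add d d 0), fun s hs => ?_⟩⟩
  refine ⟨_, _, .seq (.const ..) (.add ..), by simp, by simp, fun i hi => ?_, ?_⟩
  · rw [State.setReg_reg_of_ne _ _ hi.ne, State.setReg_reg_of_ne _ _ hi.ne]
  · simp [State.setReg_reg_of_ne _ (i := 0) (r := d) _ (by omega)]

theorem EComp.const (c : ℕ) : EComp fun _ _ _ => c := by
  refine ⟨Polynomial.C 1, fun r d hd hr => ⟨.const d c, fun s hs => ?_⟩⟩
  exact ⟨_, _, .const .., by simp, by simp, fun i hi => State.setReg_reg_of_ne _ _ hi.ne, by simp⟩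

section
variable {f g : ℕ → (ℕ → ℕ) → (ℕ → ℕ) → ℕ}

/-- Two expressions are evaluated one after the other. -/
theorem EComp.pair (hf : EComp f) (hg : EComp g) :
    ∃ T : Polynomial ℕ, ∀ (r : ℕ → ℕ) (d : ℕ), 2 ≤ d → (∀ i, r i < d) →
    ∃ P : Prog, ∀ s : State, s.reg 1 = 1 → ∃ t s', Exec P s t s' ∧ t ≤ T.eval (s.reg 0) ∧
      s'.mem = s.mem ∧ (∀ i < d, s'.reg i = s.reg i) ∧
      s'.reg d = f (s.reg 0) (fun i => s.reg (r i)) s.mem ∧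
      s'.reg (d + 1) = g (s.reg 0) (fun i => s.reg (r i)) s.mem := by
  obtain ⟨Tf, hf⟩ := hf
  obtain ⟨Tg, hg⟩ := hg
  refine ⟨Tf + Tg, fun r d hd hr => ?_⟩
  obtain ⟨P, hP⟩ := hf r d hd hr
  obtain ⟨Q, hQ⟩ := hg r (d + 1) (by omega) fun i => (hr i).trans (by omega)
  refine ⟨.seq P Q, fun s hs => ?_⟩
  obtain ⟨t, s₁, h₁, ht₁, hm₁, hr₁, hv₁⟩ := hP s hs
  obtain ⟨t', s₂, h₂, ht₂, hm₂, hr₂, hv₂⟩ := hQ s₁ (by rw [hr₁ 1 (by omega), hs])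
  rw [hr₁ 0 (by omega)] at ht₂ hv₂
  refine ⟨_, s₂, .seq h₁ h₂, by simpa using add_le_add ht₁ ht₂, hm₂.trans hm₁,
    fun i hi => (hr₂ i (by omega)).trans (hr₁ i hi), (hr₂ d (by omega)).trans hv₁, ?_⟩
  simp only [hv₂, hm₁, hr₁ _ (hr _)]

theorem EComp.add (hf : EComp f) (hg : EComp g) : EComp fun n v m => f n v m + g n v m := by
  obtain ⟨T, h⟩ := hf.pair hg
  refine ⟨T + 1, fun r d hd hr => ?_⟩
  obtain ⟨P, hP⟩ := h r d hd hr
  refine ⟨.seq P (.add d d (d + 1)), fun s hs => ?_⟩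
  obtain ⟨t, s₁, h₁, ht₁, hm₁, hr₁, hv, hw⟩ := hP s hs
  refine ⟨_, _, .seq h₁ (.add ..), by simpa using ht₁, hm₁, fun i hi => ?_, ?_⟩
  · rw [State.setReg_reg_of_ne _ _ hi.ne, hr₁ i hi]
  · simp [hv, hw]

theorem EComp.sub (hf : EComp f) (hg : EComp g) : EComp fun n v m => f n v m - g n v m := by
  obtain ⟨T, h⟩ := hf.pair hg
  refine ⟨T + 1, fun r d hd hr => ?_⟩
  obtain ⟨P, hP⟩ := h r d hd hr
  refine ⟨.seq P (.sub d d (d + 1)), fun s hs => ?_⟩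
  obtain ⟨t, s₁, h₁, ht₁, hm₁, hr₁, hv, hw⟩ := hP s hs
  refine ⟨_, _, .seq h₁ (.sub ..), by simpa using ht₁, hm₁, fun i hi => ?_, ?_⟩
  · rw [State.setReg_reg_of_ne _ _ hi.ne, hr₁ i hi]
  · simp [hv, hw]

theorem EComp.load (hf : EComp f) : EComp fun n v m => m (f n v m) := by
  obtain ⟨T, h⟩ := hf
  refine ⟨T + 1, fun r d hd hr => ?_⟩
  obtain ⟨P, hP⟩ := h r d hd hr
  refine ⟨.seq P (.load d d), fun s hs => ?_⟩
  obtain ⟨t, s₁, h₁, ht₁, hm₁, hr₁, hv⟩ := hP s hs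
  refine ⟨_, _, .seq h₁ (.load ..), by simpa using ht₁, hm₁, fun i hi => ?_, ?_⟩
  · rw [State.setReg_reg_of_ne _ _ hi.ne, hr₁ i hi]
  · simp [hv, hm₁]

theorem EComp.ite_lt (hf : EComp f) (hg : EComp g) :
    EComp fun n v m => if f n v m < g n v m then 1 else 0 := by
  obtain ⟨T, h⟩ := hf.pair hg
  refine ⟨T + 2, fun r d hd hr => ?_⟩
  obtain ⟨P, hP⟩ := h r d hd hr
  refine ⟨.seq P (.ite d (d + 1) (.const d 1) (.const d 0)), fun s hs => ?_⟩
  obtain ⟨t, s₁, h₁, ht₁, hm₁, hr₁, hv, hw⟩ := hP s hs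
  by_cases hlt : s₁.reg d < s₁.reg (d + 1)
  · refine ⟨_, _, .seq h₁ (.ite_true hlt (.const ..)), by simpa using ht₁, hm₁,
      fun i hi => ?_, ?_⟩
    · rw [State.setReg_reg_of_ne _ _ hi.ne, hr₁ i hi]
    · rw [hv, hw] at hlt
      simp [hlt]
  · refine ⟨_, _, .seq h₁ (.ite_false hlt (.const ..)), by simpa using ht₁, hm₁,
      fun i hi => ?_, ?_⟩
    · rw [State.setReg_reg_of_ne _ _ hi.ne, hr₁ i hi]
    · rw [hv, hw] at hlt
      simp [hlt]

theorem comp_push (s : ℕ → ℕ) (c : ℕ) (r : ℕ → ℕ) :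
    (fun i => s (push c r i)) = push (s c) fun i => s (r i) := by
  funext i
  cases i <;> rfl

theorem push_lt {c d : ℕ} {r : ℕ → ℕ} (hc : c < d) (hr : ∀ i, r i < d) (i : ℕ) :
    push c r i < d := by
  cases i
  exacts [hc, hr _]

/-- The only loop among expressions; bounded quantifiers and multiplication by `n` are derived from
it. Register `d` accumulates, `d + 1` counts, and the body leaves its value in `d + 2`. -/
theorem EComp.sum (hf : EComp f) :
    EComp fun n v m => ∑ k ∈ Finset.range n, f n (push k v) m := by
  obtain ⟨T, h⟩ := hf
  refine ⟨Polynomial.X * (T + 3) + 3, fun r d hd hr => ?_⟩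
  obtain ⟨P, hP⟩ := h (push (d + 1) r) (d + 2) (by omega)
    (push_lt (by omega) fun i => (hr i).trans (by omega))
  refine ⟨.seq (.seq (.const d 0) (.const (d + 1) 0))
    (.loop (d + 1) 0 (.seq P (.seq (.add d d (d + 2)) (.add (d + 1) (d + 1) 1)))),
    fun s hs => ?_⟩
  obtain ⟨t, s', hx, ht, hI⟩ := Exec.exists_loop (c := d + 1) (n := s.reg 0)
    (B := .seq P (.seq (.add d d (d + 2)) (.add (d + 1) (d + 1) 1)))
    (τ := T.eval (s.reg 0) + 2)
    (fun k s' => (∀ i < d, s'.reg i = s.reg i) ∧ s'.mem = s.mem ∧ s'.reg (d + 1) = k ∧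
      s'.reg d = ∑ j ∈ Finset.range k, f (s.reg 0) (push j fun i => s.reg (r i)) s.mem)
    (fun k s' h => ⟨h.2.2.1, h.1 0 (by omega)⟩)
    (by
      rintro k hk s₁ ⟨hr₁, hm₁, hc, hsum⟩
      obtain ⟨t, s₂, h₂, ht₂, hm₂, hr₂, hv₂⟩ := hP s₁ (by rw [hr₁ 1 (by omega), hs])
      rw [hr₁ 0 (by omega)] at ht₂ hv₂
      refine ⟨_, _, .seq h₂ (.seq (.add ..) (.add ..)), by omega, fun i hi => ?_, ?_, ?_, ?_⟩
      · rw [State.setReg_reg_of_ne _ _ (by omega), State.setReg_reg_of_ne _ _ (by omega),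
          hr₂ i (by omega), hr₁ i hi]
      · simp [hm₂, hm₁]
      · rw [State.setReg_reg_self, State.setReg_reg_of_ne _ _ (by omega),
          State.setReg_reg_of_ne _ _ (by omega), hr₂ _ (by omega), hr₂ _ (by omega), hc,
          hr₁ 1 (by omega), hs]
      · rw [State.setReg_reg_of_ne _ _ (by omega), State.setReg_reg_self, hr₂ d (by omega), hsum,
          hv₂, Finset.sum_range_succ, comp_push, hc, hm₁]
        simp only [hr₁ _ (hr _)])
    (s := (s.setReg d 0).setReg (d + 1) 0)
    (by
      refine ⟨fun i hi => ?_, rfl, by simp, ?_⟩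
      · rw [State.setReg_reg_of_ne _ _ (by omega), State.setReg_reg_of_ne _ _ (by omega)]
      · rw [State.setReg_reg_of_ne _ _ (by omega)]; simp)
  refine ⟨_, s', .seq (.seq (.const ..) (.const ..)) hx, ?_, hI.2.1, hI.1, hI.2.2.2⟩
  simp only [Polynomial.eval_add, Polynomial.eval_mul, Polynomial.eval_X,
    Polynomial.eval_ofNat]
  have : T.eval (s.reg 0) + 2 + 1 = T.eval (s.reg 0) + 3 := rfl
  rw [this] at ht
  omega

theorem EComp.congr (hf : EComp f) (h : ∀ n v m, f n v m = g n v m) : EComp g := by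
  rwa [show g = f from funext fun n => funext fun v => funext fun m => (h n v m).symm]

theorem EComp.weaken (hf : EComp f) : EComp fun n v m => f n (fun i => v (i + 1)) m := by
  obtain ⟨T, h⟩ := hf
  exact ⟨T, fun r d hd hr => h (fun i => r (i + 1)) d hd fun i => hr _⟩

/-- The machine cannot multiply, so the product is a sum of `n` equal terms. Array addresses need no
other products with a non-constant factor. -/
theorem EComp.mul_size (hf : EComp f) : EComp fun n v m => f n v m * n := by
  have := hf.weaken.sum
  simpa [push, mul_comm] using this

/-! ### Computable predicates -/

theorem PComp.lt (hf : EComp f) (hg : EComp g) : PComp fun n v m => f n v m < g n v m :=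
  ⟨_, hf.ite_lt hg, fun n v m => by split_ifs <;> simp [*]⟩

theorem PComp.congr {φ ψ : ℕ → (ℕ → ℕ) → (ℕ → ℕ) → Prop} (h : PComp φ)
    (H : ∀ n v m, φ n v m ↔ ψ n v m) : PComp ψ := by
  obtain ⟨f, hf, h⟩ := h
  exact ⟨f, hf, fun n v m => (h n v m).trans (H n v m)⟩

variable {φ ψ : ℕ → (ℕ → ℕ) → (ℕ → ℕ) → Prop}

theorem PComp.not (hφ : PComp φ) : PComp fun n v m => ¬ φ n v m := by
  obtain ⟨f, hf, h⟩ := hφ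
  refine (PComp.lt hf (.const 1)).congr fun n v m => ?_
  rw [← h]; omega

theorem PComp.or (hφ : PComp φ) (hψ : PComp ψ) : PComp fun n v m => φ n v m ∨ ψ n v m := by
  obtain ⟨f, hf, h⟩ := hφ
  obtain ⟨g, hg, h'⟩ := hψ
  refine (PComp.lt (.const 0) (hf.add hg)).congr fun n v m => ?_
  rw [← h, ← h']; omega

theorem PComp.and (hφ : PComp φ) (hψ : PComp ψ) : PComp fun n v m => φ n v m ∧ ψ n v m :=
  (hφ.not.or hψ.not).not.congr fun n v m => by tauto

theorem PComp.imp (hφ : PComp φ) (hψ : PComp ψ) : PComp fun n v m => φ n v m → ψ n v m :=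
  (hφ.not.or hψ).congr fun n v m => by tauto

theorem PComp.eq (hf : EComp f) (hg : EComp g) : PComp fun n v m => f n v m = g n v m :=
  ((PComp.lt hf hg).not.and (PComp.lt hg hf).not).congr fun n v m => by omega

theorem PComp.exists (hφ : PComp φ) : PComp fun n v m => ∃ k < n, φ n (push k v) m := by
  obtain ⟨f, hf, h⟩ := hφ
  refine (PComp.lt (.const 0) hf.sum).congr fun n v m => ?_
  simp [Finset.sum_pos_iff, h]

theorem PComp.forall (hφ : PComp φ) : PComp fun n v m => ∀ k < n, φ n (push k v) m :=
  hφ.not.exists.not.congr fun n v m => by push Not; rfl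

theorem PComp.indicator {_ : ∀ n v m, Decidable (φ n v m)} (hφ : PComp φ) :
    EComp fun n v m => if φ n v m then 1 else 0 := by
  obtain ⟨f, hf, h⟩ := hφ
  simpa only [h] using (EComp.const 0).ite_lt hf

/-! ### Computable transformations of the memory -/

theorem CComp.id : CComp fun _ _ m => m :=
  ⟨Polynomial.C 1, fun r d hd hr => ⟨.const d 0, fun s hs =>
    ⟨_, _, .const .., by simp, fun i hi => State.setReg_reg_of_ne _ _ hi.ne, by simp⟩⟩⟩

theorem CComp.store (hf : EComp f) (hg : EComp g) :
    CComp fun n v m => Function.update m (f n v m) (g n v m) := by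
  obtain ⟨T, h⟩ := hf.pair hg
  refine ⟨T + 1, fun r d hd hr => ?_⟩
  obtain ⟨P, hP⟩ := h r d hd hr
  refine ⟨.seq P (.store d (d + 1)), fun s hs => ?_⟩
  obtain ⟨t, s₁, h₁, ht₁, hm₁, hr₁, hv, hw⟩ := hP s hs
  exact ⟨_, _, .seq h₁ (.store ..), by simpa using ht₁, fun i hi => by simp [hr₁ i hi],
    by simp [hv, hw, hm₁]⟩

variable {A B : ℕ → (ℕ → ℕ) → (ℕ → ℕ) → (ℕ → ℕ)}

theorem CComp.seq (hA : CComp A) (hB : CComp B) : CComp fun n v m => B n v (A n v m) := by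
  obtain ⟨TA, hA⟩ := hA
  obtain ⟨TB, hB⟩ := hB
  refine ⟨TA + TB, fun r d hd hr => ?_⟩
  obtain ⟨P, hP⟩ := hA r d hd hr
  obtain ⟨Q, hQ⟩ := hB r d hd hr
  refine ⟨.seq P Q, fun s hs => ?_⟩
  obtain ⟨t, s₁, h₁, ht₁, hr₁, hv₁⟩ := hP s hs
  obtain ⟨t', s₂, h₂, ht₂, hr₂, hv₂⟩ := hQ s₁ (by rw [hr₁ 1 (by omega), hs])
  rw [hr₁ 0 (by omega)] at ht₂ hv₂
  refine ⟨_, s₂, .seq h₁ h₂, by simpa using add_le_add ht₁ ht₂,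
    fun i hi => (hr₂ i hi).trans (hr₁ i hi), ?_⟩
  simp only [hv₂, hv₁, hr₁ _ (hr _)]

theorem CComp.ite {inst : ∀ n v m, Decidable (φ n v m)} (hφ : PComp φ) (hA : CComp A)
    (hB : CComp B) :
    CComp fun n v m => if φ n v m then A n v m else B n v m := by
  obtain ⟨e, he, h⟩ := hφ
  obtain ⟨T₁, h₁⟩ := (EComp.const 0).pair he
  obtain ⟨TA, hA⟩ := hA
  obtain ⟨TB, hB⟩ := hB
  refine ⟨T₁ + TA + TB + 1, fun r d hd hr => ?_⟩
  obtain ⟨P, hP⟩ := h₁ r d hd hr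
  obtain ⟨Q, hQ⟩ := hA r d hd hr
  obtain ⟨R, hR⟩ := hB r d hd hr
  refine ⟨.seq P (.ite d (d + 1) Q R), fun s hs => ?_⟩
  obtain ⟨t, s₁, x₁, ht₁, hm₁, hr₁, hv, hw⟩ := hP s hs
  have hs₁ : s₁.reg 1 = 1 := by rw [hr₁ 1 (by omega), hs]
  by_cases hlt : s₁.reg d < s₁.reg (d + 1)
  · obtain ⟨t₂, s₂, x₂, ht₂, hr₂, hv₂⟩ := hQ s₁ hs₁
    rw [hr₁ 0 (by omega)] at ht₂ hv₂
    refine ⟨_, _, .seq x₁ (.ite_true hlt x₂), ?_,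
      fun i hi => (hr₂ i hi).trans (hr₁ i hi), ?_⟩
    · simp only [Polynomial.eval_add, Polynomial.eval_one]; omega
    · rw [hv, hw, h] at hlt
      beta_reduce
      rw [hv₂, if_pos hlt, hm₁]
      simp only [hr₁ _ (hr _)]
  · obtain ⟨t₂, s₂, x₂, ht₂, hr₂, hv₂⟩ := hR s₁ hs₁
    rw [hr₁ 0 (by omega)] at ht₂ hv₂
    refine ⟨_, _, .seq x₁ (.ite_false hlt x₂), ?_,
      fun i hi => (hr₂ i hi).trans (hr₁ i hi), ?_⟩
    · simp only [Polynomial.eval_add, Polynomial.eval_one]; omega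
    · rw [hv, hw, h] at hlt
      beta_reduce
      rw [hv₂, if_neg hlt, hm₁]
      simp only [hr₁ _ (hr _)]

/-- Evaluate an expression and bind its value to a new variable. -/
theorem CComp.bind (hf : EComp f) (hA : CComp A) :
    CComp fun n v m => A n (push (f n v m) v) m := by
  obtain ⟨Tf, hf⟩ := hf
  obtain ⟨TA, hA⟩ := hA
  refine ⟨Tf + TA, fun r d hd hr => ?_⟩
  obtain ⟨P, hP⟩ := hf r d hd hr
  obtain ⟨Q, hQ⟩ := hA (push d r) (d + 1) (by omega)
    (push_lt (by omega) fun i => (hr i).trans (by omega))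
  refine ⟨.seq P Q, fun s hs => ?_⟩
  obtain ⟨t, s₁, h₁, ht₁, hm₁, hr₁, hv₁⟩ := hP s hs
  obtain ⟨t', s₂, h₂, ht₂, hr₂, hv₂⟩ := hQ s₁ (by rw [hr₁ 1 (by omega), hs])
  rw [hr₁ 0 (by omega)] at ht₂ hv₂
  refine ⟨_, s₂, .seq h₁ h₂, by simpa using add_le_add ht₁ ht₂,
    fun i hi => (hr₂ i (by omega)).trans (hr₁ i hi), ?_⟩
  rw [hv₂, comp_push, hv₁, hm₁]
  simp only [hr₁ _ (hr _)]

/-- Apply `f 0, f 1, …, f (n - 1)` in turn. -/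
def forN {α : Type*} (n : ℕ) (f : ℕ → α → α) (m : α) : α :=
  Nat.rec m (fun k m => f k m) n

theorem CComp.forN (hA : CComp A) :
    CComp fun n v m => RAM.forN n (fun k m => A n (push k v) m) m := by
  obtain ⟨T, h⟩ := hA
  refine ⟨Polynomial.X * (T + 2) + 2, fun r d hd hr => ?_⟩
  obtain ⟨P, hP⟩ := h (push d r) (d + 1) (by omega)
    (push_lt (by omega) fun i => (hr i).trans (by omega))
  refine ⟨.seq (.const d 0) (.loop d 0 (.seq P (.add d d 1))), fun s hs => ?_⟩
  obtain ⟨t, s', hx, ht, hI⟩ := Exec.exists_loop (c := d) (n := s.reg 0)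
    (B := .seq P (.add d d 1)) (τ := T.eval (s.reg 0) + 1)
    (fun k s' => (∀ i < d, s'.reg i = s.reg i) ∧ s'.reg d = k ∧
      s'.mem = RAM.forN k (fun k m => A (s.reg 0) (push k fun i => s.reg (r i)) m) s.mem)
    (fun k s' h => ⟨h.2.1, h.1 0 (by omega)⟩)
    (by
      rintro k hk s₁ ⟨hr₁, hc, hm₁⟩
      obtain ⟨t, s₂, h₂, ht₂, hr₂, hv₂⟩ := hP s₁ (by rw [hr₁ 1 (by omega), hs])
      rw [hr₁ 0 (by omega)] at ht₂ hv₂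
      refine ⟨_, _, .seq h₂ (.add ..), by omega, fun i hi => ?_, ?_, ?_⟩
      · rw [State.setReg_reg_of_ne _ _ (by omega), hr₂ i (by omega), hr₁ i hi]
      · rw [State.setReg_reg_self, hr₂ _ (by omega), hr₂ _ (by omega), hc,
          hr₁ 1 (by omega), hs]
      · rw [State.setReg_mem, hv₂, comp_push, hc, hm₁]
        simp only [hr₁ _ (hr _)]
        rfl)
    (s := s.setReg d 0)
    ⟨fun i hi => State.setReg_reg_of_ne _ _ hi.ne, by simp, rfl⟩
  refine ⟨_, s', .seq (.const ..) hx, ?_, hI.1, hI.2.2⟩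
  simp only [Polynomial.eval_add, Polynomial.eval_mul, Polynomial.eval_X,
    Polynomial.eval_ofNat]
  have : T.eval (s.reg 0) + 1 + 1 = T.eval (s.reg 0) + 2 := rfl
  rw [this] at ht
  omega

end

/-- A computable transformation of the memory, followed by the evaluation of the length of the
output, gives a program for words that begin with `n`. -/
theorem exists_prog {C : ℕ → (ℕ → ℕ) → (ℕ → ℕ) → (ℕ → ℕ)} {f : ℕ → (ℕ → ℕ) → (ℕ → ℕ) → ℕ}
    (hC : CComp C) (hf : EComp f) :
    ∃ (P : Prog) (p : Polynomial ℕ), ∀ (n : ℕ) (x y : List ℕ), x.getD 0 0 = n → n ≤ x.length →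
      (f n (fun _ => n) (C n (fun _ => n) fun i => x.getD i 0) = y.length) →
      (∀ (i : ℕ) (h : i < y.length), C n (fun _ => n) (fun i => x.getD i 0) i = y[i]) →
      ∃ t, OutputsIn P x y t ∧ t ≤ p.eval x.length := by
  obtain ⟨TC, hC⟩ := hC
  obtain ⟨Tf, hf⟩ := hf
  obtain ⟨P, hP⟩ := hC (fun _ => 0) 2 le_rfl (by simp)
  obtain ⟨Q, hQ⟩ := hf (fun _ => 0) 2 le_rfl (by simp)
  -- Initially `R_1` is `0`, so the load fetches `M[0] = n`; afterwards `R_1` is the constant `1` by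
  -- which counters advance.
  refine ⟨.seq (.seq (.load 0 1) (.const 1 1)) (.seq P (.seq Q (.seq (.const 0 0) (.add 0 0 2)))),
    TC + Tf + 4, fun n x y hn hle hlen hout => ?_⟩
  set s₀ : State := ((init x).setReg 0 n).setReg 1 1 with hs₀
  have e₀ : Exec (.seq (.load 0 1) (.const 1 1)) (init x) 2 s₀ := by
    have := Exec.seq (.load (init x) 0 1) (.const _ 1 1)
    rwa [show (init x).mem ((init x).reg 1) = n from hn] at this
  have h0 : s₀.reg 0 = n := rfl
  obtain ⟨t₁, s₁, e₁, ht₁, hr₁, hm₁⟩ := hP s₀ rfl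
  obtain ⟨t₂, s₂, e₂, ht₂, hm₂, hr₂, hv₂⟩ := hQ s₁ (by rw [hr₁ 1 (by omega)]; rfl)
  rw [hr₁ 0 (by omega), h0, hm₁, h0] at hv₂
  rw [hr₁ 0 (by omega), h0] at ht₂
  rw [h0] at hm₁ ht₁
  -- The bounds are in terms of `n ≤ x.length`, and polynomials with natural coefficients are
  -- monotone.
  have hmono (T : Polynomial ℕ) : T.eval n ≤ T.eval x.length := by
    simp only [Polynomial.eval_eq_sum, Polynomial.sum_def]
    exact Finset.sum_le_sum fun i _ => by gcongr
  refine ⟨_, ⟨_, .seq e₀ (.seq e₁ (.seq e₂ (.seq (.const ..) (.add ..)))), ?_, ?_⟩, ?_⟩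
  · rw [State.setReg_reg_self, State.setReg_reg_self, zero_add,
      State.setReg_reg_of_ne _ _ (by omega), hv₂]
    exact hlen
  · intro i hi
    simp only [State.setReg_mem, hm₂, hm₁]
    exact hout i hi
  · have := hmono TC
    have := hmono Tf
    simp only [Polynomial.eval_add, Polynomial.eval_ofNat]
    omega

end RAM

namespace EdgeOpenPacking

/-! ### Edge open packings and induced paths with one or two edges -/

section
variable {V : Type*} {G : SimpleGraph V} {D D' : Finset (Sym2 V)} {a b c x y : V}

/-- The vertices `x` and `y` are equal or adjacent. -/
def Near (G : SimpleGraph V) (x y : V) : Prop := x = y ∨ G.Adj x y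

theorem Near.symm (h : Near G x y) : Near G y x := h.imp Eq.symm SimpleGraph.Adj.symm

theorem IsEOP.mono (h : IsEOP G D) (hD : D' ⊆ D) : IsEOP G D' :=
  ⟨fun _ he => h.1 (hD he), fun e₁ h₁ e₂ h₂ => h.2 e₁ (hD h₁) e₂ (hD h₂)⟩

theorem isEOP_empty : IsEOP G ∅ := ⟨by simp, by simp⟩

theorem IsEOP.union [DecidableEq V] (h : IsEOP G D) (h' : IsEOP G D')
    (hn : ∀ e ∈ D, ∀ e' ∈ D', ∀ x ∈ e, ∀ y ∈ e', ¬ Near G x y) : IsEOP G (D ∪ D') := by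
  refine ⟨by simpa using ⟨h.1, h'.1⟩, fun e₁ h₁ e₂ h₂ hne => ?_⟩
  rw [Finset.mem_union] at h₁ h₂
  rcases h₁ with h₁ | h₁ <;> rcases h₂ with h₂ | h₂
  · exact h.2 _ h₁ _ h₂ hne
  · rintro ⟨e, he, -, -, x, hx, y, hy, rfl⟩
    exact hn _ h₁ _ h₂ _ hx _ hy (.inr he)
  · rintro ⟨e, he, -, -, x, hx, y, hy, rfl⟩
    exact hn _ h₂ _ h₁ _ hy _ hx (.inr he.symm)
  · exact h'.2 _ h₁ _ h₂ hne

theorem disjoint_of_not_near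
    (hn : ∀ e ∈ D, ∀ e' ∈ D', ∀ x ∈ e, ∀ y ∈ e', ¬ Near G x y) : Disjoint D D' := by
  refine Finset.disjoint_left.2 fun e he he' => ?_
  induction e with
  | h x y => exact hn _ he _ he' x (by simp) x (by simp) (.inl rfl)

/-- A common edge could only be `ac`, a loop at `b`, or one of the two edges themselves. The case `a
= c` is allowed, so single edges are treated together with paths of two edges. -/
theorem isEOP_pair [DecidableEq V] (hab : G.Adj a b) (hcb : G.Adj c b) (hac : ¬ G.Adj a c) :
    IsEOP G {s(a, b), s(c, b)} := by
  refine ⟨by simp [Set.insert_subset_iff, hab, hcb], ?_⟩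
  have key : ∀ e, ¬ IsCommonEdge G s(a, b) s(c, b) e := by
    rintro e ⟨he, h₁, h₂, x, hx, y, hy, rfl⟩
    rw [Sym2.mem_iff] at hx hy
    rcases hx with rfl | rfl <;> rcases hy with rfl | rfl
    · exact hac he
    · exact h₁ rfl
    · exact h₂ Sym2.eq_swap
    · exact G.loopless.irrefl _ he
  intro e₁ h₁ e₂ h₂ hne ⟨e, he⟩
  simp only [Finset.mem_insert, Finset.mem_singleton] at h₁ h₂
  rcases h₁ with rfl | rfl <;> rcases h₂ with rfl | rfl
  · exact hne rfl
  · exact key e he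
  · obtain ⟨he, h₁, h₂, x, hx, y, hy, rfl⟩ := he
    exact key s(x, y) ⟨he, h₂, h₁, y, hy, x, hx, Sym2.eq_swap⟩
  · exact hne rfl

theorem card_pair_edges [DecidableEq V] (hcb : c ≠ b) :
    ({s(a, b), s(c, b)} : Finset (Sym2 V)).card = if a = c then 1 else 2 := by
  split_ifs with h
  · simp [h]
  · rw [Finset.card_pair]
    simp [h, hcb.symm]

/-- Edges of an edge open packing with a common endpoint have non-adjacent other endpoints. -/
theorem IsEOP.not_adj (h : IsEOP G D) (hab : s(a, b) ∈ D) (hcb : s(c, b) ∈ D) :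
    ¬ G.Adj a c := by
  intro hac
  have hcb' : c ≠ b := G.ne_of_adj (h.1 hcb)
  have hab' : a ≠ b := G.ne_of_adj (h.1 hab)
  have hac' := G.ne_of_adj hac
  refine h.2 _ hab _ hcb (by simp [hac', hab']) ⟨s(a, c), hac, ?_, ?_, a, by simp, c, by simp, rfl⟩
  · simp [hcb', hab']
  · simp [hac', hab']

/-- At an end of an induced path with two edges of an edge open packing, there are no further
edges of it. -/
theorem IsEOP.eq_of_mem (h : IsEOP G D) (hab : s(a, b) ∈ D) (hcb : s(c, b) ∈ D) (hac : a ≠ c)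
    {e : Sym2 V} (he : e ∈ D) (hae : a ∈ e) : e = s(a, b) := by
  by_contra hne
  have hab' : a ≠ b := G.ne_of_adj (h.1 hab)
  refine h.2 _ he _ hcb ?_ ⟨s(a, b), h.1 hab, Ne.symm hne, ?_, a, hae, b, by simp, rfl⟩
  · rintro rfl
    rw [Sym2.mem_iff] at hae
    tauto
  · simp [hac, hab']

/-- The other edges of an edge open packing are far from an isolated component of it. -/
theorem IsEOP.not_near (h : IsEOP G D) (hD : D' ⊆ D)
    (hiso : ∀ e ∈ D', ∀ f ∈ D, ∀ x ∈ e, x ∈ f → f ∈ D')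
    {e f : Sym2 V} (he : e ∈ D') (hf : f ∈ D) (hf' : f ∉ D') (hx : x ∈ e) (hy : y ∈ f) :
    ¬ Near G x y := by
  rintro (rfl | hxy)
  · exact hf' (hiso e he f hf x hx hy)
  · refine h.2 e (hD he) f hf (by rintro rfl; exact hf' he) ⟨s(x, y), hxy, ?_, ?_, x, hx, y, hy, rfl⟩
    · rintro rfl
      exact hf' (hiso _ he f hf y (by simp) hy)
    · rintro rfl
      exact hf' (hiso e he _ hf x hx (by simp))

/-! ### The packing number of a graph and of its induced subgraphs -/

variable [Finite V]

theorem eopNumber_isGreatest (G : SimpleGraph V) :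
    IsGreatest {m : ℕ | ∃ D : Finset (Sym2 V), IsEOP G D ∧ D.card = m} (eopNumber G) := by
  have hne : {m : ℕ | ∃ D : Finset (Sym2 V), IsEOP G D ∧ D.card = m}.Nonempty :=
    ⟨0, ∅, isEOP_empty, rfl⟩
  have hbdd : BddAbove {m : ℕ | ∃ D : Finset (Sym2 V), IsEOP G D ∧ D.card = m} := by
    classical
    have := Fintype.ofFinite V
    refine ⟨Fintype.card (Sym2 V), ?_⟩
    rintro m ⟨D, -, rfl⟩
    exact Finset.card_le_univ D
  exact ⟨Nat.sSup_mem hne hbdd, fun m hm => le_csSup hbdd hm⟩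

theorem IsEOP.card_le (h : IsEOP G D) : D.card ≤ eopNumber G :=
  (eopNumber_isGreatest G).2 ⟨D, h, rfl⟩

/-- A common edge has its ends among the endpoints of the two given edges, so packings of `G.induce
S` are the packings of `G` inside `S`. This avoids subtype vertices from here on. -/
theorem eopNumber_induce_isGreatest (G : SimpleGraph V) (S : Set V) :
    IsGreatest {m : ℕ | ∃ D : Finset (Sym2 V), IsEOP G D ∧ (∀ e ∈ D, ∀ x ∈ e, x ∈ S) ∧
      D.card = m} (eopNumber (G.induce S)) := by
  classical
  have hinj : Function.Injective (Sym2.map ((↑) : S → V)) :=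
    Sym2.map.injective Subtype.val_injective
  constructor
  · obtain ⟨D, hD, hc⟩ := (eopNumber_isGreatest (G.induce S)).1
    refine ⟨D.map ⟨_, hinj⟩, ⟨?_, ?_⟩, ?_, by rw [Finset.card_map, hc]⟩
    · intro e he
      simp only [Finset.coe_map, Function.Embedding.coeFn_mk, Set.mem_image, Finset.mem_coe] at he
      obtain ⟨e, he, rfl⟩ := he
      have := hD.1 he
      induction e with
      | h x y => exact this
    · intro e₁ h₁ e₂ h₂ hne
      simp only [Finset.mem_map, Function.Embedding.coeFn_mk] at h₁ h₂
      obtain ⟨e₁, h₁, rfl⟩ := h₁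
      obtain ⟨e₂, h₂, rfl⟩ := h₂
      rintro ⟨e, he, hn₁, hn₂, x, hx, y, hy, rfl⟩
      rw [Sym2.mem_map] at hx hy
      obtain ⟨x, hx, rfl⟩ := hx
      obtain ⟨y, hy, rfl⟩ := hy
      refine hD.2 e₁ h₁ e₂ h₂ (fun h => hne (by rw [h])) ⟨s(x, y), he, ?_, ?_, x, hx, y, hy, rfl⟩
      · rintro rfl; exact hn₁ rfl
      · rintro rfl; exact hn₂ rfl
    · intro e he x hx
      simp only [Finset.mem_map, Function.Embedding.coeFn_mk] at he
      obtain ⟨e, he, rfl⟩ := he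
      rw [Sym2.mem_map] at hx
      obtain ⟨x, hx, rfl⟩ := hx
      exact x.2
  · rintro m ⟨D, hD, hS, rfl⟩
    have hpre : ∀ e ∈ D, ∃ e', Sym2.map ((↑) : S → V) e' = e := by
      intro e he
      have := hS e he
      induction e with
      | h x y => exact ⟨s(⟨x, this x (by simp)⟩, ⟨y, this y (by simp)⟩), rfl⟩
    have hEOP : IsEOP (G.induce S) (D.preimage _ hinj.injOn) := by
      refine ⟨fun e he => ?_, fun e₁ h₁ e₂ h₂ hne => ?_⟩
      · simp only [Finset.coe_preimage, Set.mem_preimage, Finset.mem_coe] at he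
        have := hD.1 he
        induction e with
        | h x y => exact this
      · rw [Finset.mem_preimage] at h₁ h₂
        rintro ⟨e, he, hn₁, hn₂, x, hx, y, hy, rfl⟩
        refine hD.2 _ h₁ _ h₂ (hinj.ne hne) ⟨s(↑x, ↑y), he, fun h => hn₁ (hinj h),
          fun h => hn₂ (hinj h), x, ?_, y, ?_, rfl⟩
        · exact Sym2.mem_map.2 ⟨x, hx, rfl⟩
        · exact Sym2.mem_map.2 ⟨y, hy, rfl⟩
    have hcard : (D.preimage _ hinj.injOn).card = D.card := by
      rw [← Finset.card_image_of_injective _ hinj, Finset.image_preimage]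
      congr 1
      exact Finset.filter_true_of_mem fun e he => hpre e he
    rw [← hcard]
    exact hEOP.card_le

end

end EdgeOpenPacking

namespace EdgeOpenPacking

/-! ### Bi-compatible elimination orderings of connected graphs -/

section
variable {V : Type*} {n : ℕ} {G : SimpleGraph V} {σ : Fin n ≃ V}

theorem _root_.Relation.ReflTransGen.imp {α : Type*} {r p : α → α → Prop} {a b : α}
    (hab : Relation.ReflTransGen r a b) (h : ∀ x y, r x y → p x y) :
    Relation.ReflTransGen p a b :=
  Relation.ReflTransGen.mono h _ _ hab

theorem IsPEO.near (h : IsPEO G σ) {i r s : Fin n} (hr : i ≤ r) (hs : i ≤ s)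
    (hir : G.Adj (σ i) (σ r)) (his : G.Adj (σ i) (σ s)) : Near G (σ r) (σ s) := by
  by_contra hn
  simp only [Near, not_or] at hn
  have := h i (x := ⟨σ r, by simpa⟩) (.inr hir) (y := ⟨σ s, by simpa⟩) (.inr his)
    (by simpa using hn.1)
  exact hn.2 this

theorem IsBCO.near_of_le (h : IsBCO G σ) {i r s : Fin n} (hr : r ≤ i) (hs : s ≤ i)
    (hir : G.Adj (σ i) (σ r)) (his : G.Adj (σ i) (σ s)) : Near G (σ r) (σ s) := by
  have := h.2.near (i := i.rev) (r := r.rev) (s := s.rev) (by simpa) (by simpa)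
    (by simpa using hir) (by simpa using his)
  simpa using this

/-- In a bi-compatible elimination ordering of a connected graph, positions between `i` and `j`
suffice to connect `σ i` to `σ j`. -/
theorem IsBCO.reflTransGen (hG : G.Connected) (h : IsBCO G σ) (i j : Fin n) (hij : i ≤ j) :
    Relation.ReflTransGen
      (fun r s : Fin n => G.Adj (σ r) (σ s) ∧ (i ≤ r ∧ r ≤ j) ∧ (i ≤ s ∧ s ≤ j)) i j := by
  -- `K` is the set of positions through which we are still allowed to walk
  have step : ∀ (K : Fin n → Prop) (q : Fin n),
      (∀ r s, K r → K s → G.Adj (σ q) (σ r) → G.Adj (σ q) (σ s) → Near G (σ r) (σ s)) →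
      ∀ a b, a ≠ q → b ≠ q →
      Relation.ReflTransGen (fun r s => G.Adj (σ r) (σ s) ∧ K r ∧ K s) a b →
      Relation.ReflTransGen (fun r s => G.Adj (σ r) (σ s) ∧ (K r ∧ r ≠ q) ∧ (K s ∧ s ≠ q)) a b := by
    intro K q hq a b ha hb hab
    -- Detour around `q`: whenever the walk stands at `q`, a neighbour `c` of `q` reached without
    -- `q` is remembered. The vertex to which the walk moves on is another neighbour of `q`, hence
    -- equal or adjacent to `c`.
    suffices H : (b ≠ q → Relation.ReflTransGen
        (fun r s => G.Adj (σ r) (σ s) ∧ (K r ∧ r ≠ q) ∧ (K s ∧ s ≠ q)) a b) ∧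
        (b = q → ∃ c, c ≠ q ∧ K c ∧ G.Adj (σ q) (σ c) ∧ Relation.ReflTransGen
        (fun r s => G.Adj (σ r) (σ s) ∧ (K r ∧ r ≠ q) ∧ (K s ∧ s ≠ q)) a c) from H.1 hb
    clear hb
    induction hab with
    | refl => exact ⟨fun _ => .refl, fun h => absurd h ha⟩
    | @tail b c hab hbc ih =>
      obtain ⟨hadj, hKb, hKc⟩ := hbc
      constructor
      · intro hc
        by_cases hb : b = q
        · obtain ⟨d, hd, hKd, hqd, hwalk⟩ := ih.2 hb
          subst hb
          rcases hq d c hKd hKc hqd hadj with he | he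
          · rwa [← σ.injective he]
          · exact hwalk.tail ⟨he, ⟨hKd, hd⟩, hKc, hc⟩
        · exact (ih.1 hb).tail ⟨hadj, ⟨hKb, hb⟩, hKc, hc⟩
      · rintro rfl
        have hb : b ≠ c := fun hb => G.ne_of_adj hadj (by rw [hb])
        exact ⟨b, hb, hKb, hadj.symm, ih.1 hb⟩
  have h0 : ∀ a b, Relation.ReflTransGen
      (fun r s : Fin n => G.Adj (σ r) (σ s) ∧ True ∧ True) a b := by
    intro a b
    have := (SimpleGraph.reachable_iff_reflTransGen _ _).1 (hG.preconnected (σ a) (σ b))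
    have := this.lift (p := fun r s : Fin n => G.Adj (σ r) (σ s) ∧ True ∧ True) σ.symm
      fun x y hxy => by simpa [Function.onFun] using hxy
    simpa [Function.onFun] using this
  -- Remove the positions `0, …, i - 1` from the left, each simplicial among the later ones.
  have h1 : ∀ k : ℕ, k ≤ i.val → ∀ a b : Fin n, i ≤ a → i ≤ b → Relation.ReflTransGen
      (fun r s : Fin n => G.Adj (σ r) (σ s) ∧ k ≤ r.val ∧ k ≤ s.val) a b := by
    intro k
    induction k with
    | zero => intro _ a b _ _; simpa using h0 a b
    | succ k ih =>
      intro hk a b ha hb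
      have hki : k < n := by omega
      refine (step (fun r => k ≤ r.val) ⟨k, hki⟩
        (fun r s hr hs => h.1.near hr hs) a b
        (by rintro rfl; simp [Fin.le_def] at ha; omega)
        (by rintro rfl; simp [Fin.le_def] at hb; omega)
        (ih (by omega) a b ha hb)).imp ?_
      rintro r s ⟨hadj, hrs⟩
      refine ⟨hadj, ?_⟩
      simp only [ne_eq, Fin.ext_iff] at hrs ⊢
      omega
  -- Remove the positions after `j` from the right, each simplicial among the earlier ones by the
  -- reversed ordering.
  have h2 : ∀ k : ℕ, k + j.val < n → Relation.ReflTransGen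
      (fun r s : Fin n => G.Adj (σ r) (σ s) ∧ (i.val ≤ r.val ∧ r.val + k < n) ∧
        (i.val ≤ s.val ∧ s.val + k < n)) i j := by
    intro k
    induction k with
    | zero =>
      intro _
      refine (h1 i le_rfl i j le_rfl hij).imp fun r s hrs => ?_
      have := r.2
      have := s.2
      tauto
    | succ k ih =>
      intro hk
      refine (step (fun r => i.val ≤ r.val ∧ r.val + k < n) ⟨n - 1 - k, by omega⟩
        (fun r s hr hs => h.near_of_le (Fin.le_def.2 (by dsimp only; omega))
          (Fin.le_def.2 (by dsimp only; omega))) i j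
        (by rw [ne_eq, Fin.ext_iff]; dsimp only; rw [Fin.le_def] at hij; omega)
        (by rw [ne_eq, Fin.ext_iff]; dsimp only; omega) (ih (by omega))).imp ?_
      rintro r s ⟨hadj, hrs⟩
      refine ⟨hadj, ?_⟩
      simp only [ne_eq, Fin.ext_iff] at hrs ⊢
      omega
  refine (h2 (n - 1 - j) (by omega)).imp fun r s hrs => ⟨hrs.1, ?_⟩
  have := hrs.2
  simp only [Fin.le_def]
  omega

/-- A walk from `i` to `j` that stays between these consecutive positions must step directly to `j`.
-/
theorem IsBCO.adj_succ (hG : G.Connected) (h : IsBCO G σ) {i j : Fin n}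
    (hij : i.val + 1 = j.val) : G.Adj (σ i) (σ j) := by
  have := h.reflTransGen hG i j (by rw [Fin.le_def]; omega)
  rcases Relation.ReflTransGen.cases_head this with he | ⟨k, ⟨hadj, -, hk⟩, -⟩
  · rw [he] at hij; omega
  · have hki : k ≠ i := by rintro rfl; exact G.loopless.irrefl _ hadj
    simp only [Fin.le_def, ne_eq, Fin.ext_iff] at hk hki
    obtain rfl : k = j := by ext; omega
    exact hadj

/-- An edge of a connected graph spans a clique of a bi-compatible elimination ordering. -/
theorem IsBCO.adj_of_le (hG : G.Connected) (h : IsBCO G σ) {i j r s : Fin n}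
    (hij : G.Adj (σ i) (σ j)) (hir : i ≤ r) (hrs : r < s) (hsj : s ≤ j) : G.Adj (σ r) (σ s) := by
  -- Shift the left end to the right: position `r - 1` sees both `r` and `j`, which come later, so
  -- these are adjacent.
  have left : ∀ k : ℕ, ∀ r : Fin n, r.val = i.val + k → r < j → G.Adj (σ r) (σ j) := by
    intro k
    induction k with
    | zero =>
      intro r hr _
      rwa [show r = i from Fin.ext hr]
    | succ k ih =>
      intro r hr hrj
      rw [Fin.lt_def] at hrj
      have hp := ih ⟨i + k, by omega⟩ rfl (by rw [Fin.lt_def]; dsimp only; omega)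
      have hs := h.adj_succ hG (i := ⟨i + k, by omega⟩) (j := r) (by dsimp only; omega)
      refine (h.1.near ?_ ?_ hs hp).resolve_left fun he => ?_
      · rw [Fin.le_def]; dsimp only; omega
      · rw [Fin.le_def]; dsimp only; omega
      · rw [σ.injective he] at hrj; omega
  -- Shift the right end to the left in the same way, with the reversed ordering.
  have right : ∀ k : ℕ, ∀ s : Fin n, s.val + k = j.val → r < s → G.Adj (σ r) (σ s) := by
    intro k
    induction k with
    | zero =>
      intro s hs hrs
      obtain rfl : s = j := Fin.ext hs
      rw [Fin.le_def] at hir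
      exact left (r - i) r (by omega) hrs
    | succ k ih =>
      intro s hs hrs
      rw [Fin.lt_def] at hrs
      have hp := ih ⟨s + 1, by omega⟩ (by dsimp only; omega) (by rw [Fin.lt_def]; dsimp only; omega)
      have hs := h.adj_succ hG (i := s) (j := ⟨s + 1, by omega⟩) rfl
      refine (h.near_of_le ?_ ?_ hp.symm hs.symm).resolve_left fun he => ?_
      · rw [Fin.le_def]; dsimp only; omega
      · rw [Fin.le_def]; dsimp only; omega
      · rw [σ.injective he] at hrs; omega
  rw [Fin.le_def] at hsj
  exact right (j - s) s (by omega) hrs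

theorem le_lastNbr (G : SimpleGraph V) (σ : Fin n ≃ V) (i : Fin n) : i ≤ lastNbr G σ i :=
  Finset.le_max' _ _ (by simp)

theorem le_lastNbr_of_adj {i r : Fin n} (h : G.Adj (σ i) (σ r)) : r ≤ lastNbr G σ i := by
  rcases le_or_gt r i with hr | hr
  · exact hr.trans (le_lastNbr G σ i)
  · exact Finset.le_max' _ _ (by simp [hr, h])

theorem adj_lastNbr {i : Fin n} (h : i < lastNbr G σ i) : G.Adj (σ i) (σ (lastNbr G σ i)) := by
  classical
  have := Finset.max'_mem (Finset.univ.filter fun r => r = i ∨ (i < r ∧ G.Adj (σ i) (σ r)))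
    ⟨i, by simp⟩
  change lastNbr G σ i ∈ _ at this
  simp only [Finset.mem_filter, Finset.mem_univ, true_and] at this
  exact (this.resolve_left h.ne').2

theorem IsBCO.adj_of_le_lastNbr (hG : G.Connected) (h : IsBCO G σ) {i r s : Fin n}
    (hir : i ≤ r) (hrs : r < s) (hs : s ≤ lastNbr G σ i) : G.Adj (σ r) (σ s) :=
  h.adj_of_le hG (adj_lastNbr ((hir.trans_lt hrs).trans_le hs)) hir hrs hs

theorem IsBCO.lastNbr_mono (hG : G.Connected) (h : IsBCO G σ) {i j : Fin n} (hij : i ≤ j) :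
    lastNbr G σ i ≤ lastNbr G σ j := by
  rcases le_or_gt (lastNbr G σ i) j with hl | hl
  · exact hl.trans (le_lastNbr G σ j)
  · exact le_lastNbr_of_adj (h.adj_of_le_lastNbr hG hij hl le_rfl)

theorem IsBCO.not_near_of_lastNbr_lt (hG : G.Connected) (h : IsBCO G σ) {i j r : Fin n}
    (hij : i ≤ j) (hr : lastNbr G σ j < r) : ¬ Near G (σ i) (σ r) := by
  have hi := (h.lastNbr_mono hG hij).trans_lt hr
  rintro (he | he)
  · rw [σ.injective he] at hi
    exact (le_lastNbr G σ r).not_gt hi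
  · exact (le_lastNbr_of_adj he).not_gt hi

end

/-! ### The recursion -/

section
variable {V : Type*} [Finite V] {n : ℕ} {G : SimpleGraph V} {σ : Fin (n + 1) ≃ V}

/-- An induced path with one or two edges extends packings beyond its last neighbour. -/
theorem IsBCO.card_add_le (hG : G.Connected) (h : IsBCO G σ) {a b c m : Fin (n + 1)}
    (hab : G.Adj (σ a) (σ b)) (hcb : G.Adj (σ c) (σ b)) (hac : ¬ G.Adj (σ a) (σ c))
    (ha : a ≤ m) (hb : b ≤ m) (hc : c ≤ m) :
    (if a = c then 1 else 2) + eopNumber (suffixAfter G σ (lastNbr G σ m)) ≤ eopNumber G := by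
  classical
  obtain ⟨D, hD, hS, hcard⟩ :=
    (eopNumber_induce_isGreatest G {v | lastNbr G σ m < σ.symm v}).1
  rw [suffixAfter, ← hcard]
  have hn : ∀ e ∈ ({s(σ a, σ b), s(σ c, σ b)} : Finset (Sym2 V)), ∀ e' ∈ D,
      ∀ x ∈ e, ∀ y ∈ e', ¬ Near G x y := by
    intro e he e' he' x hx y hy
    obtain ⟨i, hi, rfl⟩ : ∃ i ≤ m, x = σ i := by
      simp only [Finset.mem_insert, Finset.mem_singleton] at he
      rcases he with rfl | rfl <;> rw [Sym2.mem_iff] at hx <;> rcases hx with rfl | rfl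
      exacts [⟨a, ha, rfl⟩, ⟨b, hb, rfl⟩, ⟨c, hc, rfl⟩, ⟨b, hb, rfl⟩]
    have := h.not_near_of_lastNbr_lt hG hi (hS e' he' y hy)
    rwa [Equiv.apply_symm_apply] at this
  have hU := (isEOP_pair hab hcb hac).union hD hn
  have := hU.card_le
  rw [Finset.card_union_of_disjoint (disjoint_of_not_near hn),
    card_pair_edges (G.ne_of_adj hcb)] at this
  simpa using this

/-- Removing an isolated component of a packing that covers an initial segment leaves a packing
of the rest. -/
theorem card_le_of_isolated {D D' : Finset (Sym2 V)} {m : Fin (n + 1)} (hD : IsEOP G D)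
    (hD' : D' ⊆ D) (hiso : ∀ e ∈ D', ∀ f ∈ D, ∀ x ∈ e, x ∈ f → f ∈ D')
    (hcov : ∀ q ≤ m, ∃ e ∈ D', ∃ x ∈ e, Near G x (σ q)) :
    D.card ≤ D'.card + eopNumber (suffixAfter G σ m) := by
  classical
  rw [← Finset.card_sdiff_add_card_eq_card hD', add_comm]
  refine Nat.add_le_add_left ((eopNumber_induce_isGreatest G {v | m < σ.symm v}).2
    ⟨_, hD.mono Finset.sdiff_subset, fun f hf y hy => ?_, rfl⟩) _
  rw [Finset.mem_sdiff] at hf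
  by_contra hm
  obtain ⟨e, he, x, hx, hn⟩ := hcov (σ.symm y) (not_lt.1 hm)
  rw [Equiv.apply_symm_apply] at hn
  exact hD.not_near hD' hiso he hf.1 hf.2 hx hy hn

/-- For attainment, a maximum packing is split at the component containing `σ 0`. If there is none,
the packing avoids `σ 0`; otherwise the component is `σ 0 σ j` or the path `σ 0 σ j σ p`, and it
dominates every position up to the last neighbour of its last vertex. -/
theorem IsBCO.eopNumber_isGreatest (hG : G.Connected) (h : IsBCO G σ) :
    IsGreatest
      ({m : ℕ | ∃ j : Fin (n + 1), 0 < j ∧ j ≤ lastNbr G σ 0 ∧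
          m = 1 + eopNumber (suffixAfter G σ (lastNbr G σ j))} ∪
       {m : ℕ | ∃ j p : Fin (n + 1), 0 < j ∧ j ≤ lastNbr G σ 0 ∧
          lastNbr G σ 0 < p ∧ p ≤ lastNbr G σ j ∧
          m = 2 + eopNumber (suffixAfter G σ (lastNbr G σ p))} ∪
       {eopNumber (suffixAfter G σ 0)})
      (eopNumber G) := by
  classical
  have hone : ∀ j : Fin (n + 1), 0 < j → j ≤ lastNbr G σ 0 →
      1 + eopNumber (suffixAfter G σ (lastNbr G σ j)) ≤ eopNumber G := by
    intro j hj hj'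
    have hadj := h.adj_of_le_lastNbr hG le_rfl hj hj'
    simpa using h.card_add_le hG hadj hadj (G.loopless.irrefl _) hj.le le_rfl hj.le
  have htwo : ∀ j p : Fin (n + 1), 0 < j → j ≤ lastNbr G σ 0 → lastNbr G σ 0 < p →
      p ≤ lastNbr G σ j → 2 + eopNumber (suffixAfter G σ (lastNbr G σ p)) ≤ eopNumber G := by
    intro j p hj hj' hp hp'
    have hadj := h.adj_of_le_lastNbr hG le_rfl hj hj'
    have hadj' := h.adj_of_le_lastNbr hG le_rfl (hj'.trans_lt hp) hp'
    have := h.card_add_le hG (m := p) hadj hadj'.symm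
      (fun h' => (le_lastNbr_of_adj h').not_gt hp) (Fin.zero_le _) (hj'.trans hp.le) le_rfl
    rwa [if_neg ((hj.trans_le hj').trans hp).ne] at this
  have hzero : eopNumber (suffixAfter G σ 0) ≤ eopNumber G := by
    obtain ⟨D, hD, -, hcard⟩ := (eopNumber_induce_isGreatest G {v | 0 < σ.symm v}).1
    rw [suffixAfter, ← hcard]
    exact hD.card_le
  refine ⟨?_, ?_⟩
  · obtain ⟨D, hD, hcard⟩ := (EdgeOpenPacking.eopNumber_isGreatest G).1
    by_cases h0 : ∃ e ∈ D, σ 0 ∈ e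
    · obtain ⟨e, he, h0e⟩ := h0
      obtain ⟨v, rfl⟩ := Sym2.mem_iff_exists.1 h0e
      obtain ⟨j, rfl⟩ := σ.surjective v
      have hadj : G.Adj (σ 0) (σ j) := hD.1 he
      have hj : 0 < j := Fin.pos_iff_ne_zero.2 fun hj => G.ne_of_adj hadj (by rw [hj])
      have hjl := le_lastNbr_of_adj hadj
      -- `σ 0` lies on only one edge of the packing
      have huniq : ∀ f ∈ D, σ 0 ∈ f → f = s(σ 0, σ j) := by
        intro f hf h0f
        obtain ⟨w, rfl⟩ := Sym2.mem_iff_exists.1 h0f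
        obtain ⟨r, rfl⟩ := σ.surjective w
        rcases h.1.near (Fin.zero_le r) (Fin.zero_le j) (hD.1 hf) hadj with hn | hn
        · rw [hn]
        · rw [Sym2.eq_swap] at hf he
          exact absurd hn (hD.not_adj hf he)
      by_cases hj' : ∀ f ∈ D, σ j ∈ f → f = s(σ 0, σ j)
      · refine .inl (.inl ⟨j, hj, hjl, le_antisymm ?_ (hone j hj hjl)⟩)
        rw [← hcard]
        refine (card_le_of_isolated (D' := {s(σ 0, σ j)}) hD (by simpa) ?_ ?_).trans_eq
          (by rw [Finset.card_singleton])
        · intro e he f hf x hx hxf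
          rw [Finset.mem_singleton] at he ⊢
          rw [he, Sym2.mem_iff] at hx
          rcases hx with rfl | rfl
          exacts [huniq f hf hxf, hj' f hf hxf]
        · intro q hq
          refine ⟨_, Finset.mem_singleton_self _, σ j, by simp, ?_⟩
          rcases lt_trichotomy q j with hqj | rfl | hqj
          · exact .inr (h.adj_of_le hG hadj (Fin.zero_le q) hqj le_rfl).symm
          · exact .inl rfl
          · exact .inr (h.adj_of_le_lastNbr hG le_rfl hqj hq)
      · push Not at hj'
        obtain ⟨f, hf, hjf, hfne⟩ := hj'
        obtain ⟨w, rfl⟩ := Sym2.mem_iff_exists.1 hjf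
        obtain ⟨p, rfl⟩ := σ.surjective w
        rw [Sym2.eq_swap] at hf
        have hjp : G.Adj (σ j) (σ p) := (hD.1 hf).symm
        have h0p : (0 : Fin (n + 1)) ≠ p := by rintro rfl; exact hfne Sym2.eq_swap
        have hnadj : ¬ G.Adj (σ 0) (σ p) := hD.not_adj he hf
        -- All other positions up to `lastNbr G σ 0` are adjacent to `σ 0`, which the packing
        -- forbids for `σ p`.
        have hp : lastNbr G σ 0 < p := by
          by_contra hp
          exact hnadj (h.adj_of_le_lastNbr hG le_rfl (Fin.pos_iff_ne_zero.2 h0p.symm) (not_lt.1 hp))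
        have hp' := le_lastNbr_of_adj hjp
        refine .inl (.inr ⟨j, p, hj, hjl, hp, hp', le_antisymm ?_ (htwo j p hj hjl hp hp')⟩)
        rw [← hcard]
        refine (card_le_of_isolated (D' := {s(σ 0, σ j), s(σ p, σ j)}) hD ?_ ?_ ?_).trans_eq
          (by rw [card_pair_edges (G.ne_of_adj hjp.symm), if_neg (σ.injective.ne h0p)])
        · simp [Finset.insert_subset_iff, he, hf]
        -- A third edge `σ j σ q` would also have `q` beyond `lastNbr G σ 0`. Then `p` and `q` are
        -- both later neighbours of `σ j`, hence equal or adjacent, and adjacency violates the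
        -- packing.
        · have hj0 : ∀ f ∈ D, σ j ∈ f → f = s(σ 0, σ j) ∨ f = s(σ p, σ j) := by
            intro g hg hjg
            by_contra! hne
            obtain ⟨w, rfl⟩ := Sym2.mem_iff_exists.1 hjg
            obtain ⟨q, rfl⟩ := σ.surjective w
            rw [Sym2.eq_swap] at hg hne
            have h0q : (0 : Fin (n + 1)) ≠ q := by rintro rfl; exact hne.1 rfl
            have hq : lastNbr G σ 0 < q := by
              by_contra hq
              exact hD.not_adj he hg (h.adj_of_le_lastNbr hG le_rfl
                (Fin.pos_iff_ne_zero.2 h0q.symm) (not_lt.1 hq))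
            rcases h.1.near (hjl.trans hp.le) (hjl.trans hq.le) hjp (hD.1 hg).symm with hn | hn
            · exact hne.2 (by rw [hn])
            · exact hD.not_adj hf hg hn
          intro e' he' f' hf' x hx hxf
          simp only [Finset.mem_insert, Finset.mem_singleton] at he' ⊢
          have hx' : x = σ 0 ∨ x = σ j ∨ x = σ p := by
            rcases he' with rfl | rfl <;> rw [Sym2.mem_iff] at hx <;> tauto
          rcases hx' with rfl | rfl | rfl
          · exact .inl (huniq f' hf' hxf)
          · exact hj0 f' hf' hxf
          · exact .inr (hD.eq_of_mem hf he (σ.injective.ne h0p.symm) hf' hxf)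
        · intro q hq
          refine ⟨s(σ p, σ j), by simp, ?_⟩
          rcases lt_trichotomy q p with hqp | rfl | hqp
          · refine ⟨σ j, by simp, ?_⟩
            rcases lt_trichotomy q j with hqj | rfl | hqj
            · exact .inr (h.adj_of_le hG hadj (Fin.zero_le q) hqj le_rfl).symm
            · exact .inl rfl
            · exact .inr (h.adj_of_le hG hjp le_rfl hqj hqp.le)
          · exact ⟨σ q, by simp, .inl rfl⟩
          · exact ⟨σ p, by simp, .inr (h.adj_of_le_lastNbr hG le_rfl hqp hq)⟩
    · refine .inr (le_antisymm ?_ hzero)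
      rw [← hcard]
      refine (eopNumber_induce_isGreatest G {v | 0 < σ.symm v}).2
        ⟨D, hD, fun e he x hx => Fin.pos_iff_ne_zero.2 fun hx0 => h0 ⟨e, he, ?_⟩, rfl⟩
      rw [← hx0, Equiv.apply_symm_apply]
      exact hx
  · rintro m ((⟨j, hj, hj', rfl⟩ | ⟨j, p, hj, hj', hp, hp', rfl⟩) | rfl)
    exacts [hone j hj hj', htwo j p hj hj' hp hp', hzero]

end

end EdgeOpenPacking

namespace EdgeOpenPacking

/-! ### Maximum weight independent sets by the local ratio method -/

section
variable {P : Type*}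

/-- No two distinct elements of `S` are in conflict. -/
def Indep (conf : P → P → Prop) (S : Finset P) : Prop :=
  ∀ p ∈ S, ∀ q ∈ S, p ≠ q → ¬ conf p q

open Classical in
/-- Extend `S` greedily by the elements of a list that are not in conflict with those chosen. -/
noncomputable def complete (conf : P → P → Prop) (S : Finset P) : List P → Finset P
  | [] => S
  | v :: L => complete conf (if ∃ q ∈ S, conf v q then S else insert v S) L

/-- After the elements of `L` have been processed (the head being the last one), `w` is what is
left of the weight `w₀`: every solution for `w` extends to one for `w₀` that gains at least as much
as any solution can gain. -/
def LocalRatio (conf : P → P → Prop) (w₀ w : P → ℕ) (L : List P) : Prop :=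
  ∃ c, (∀ I, Indep conf I → ∑ p ∈ I, w₀ p ≤ ∑ p ∈ I, w p + c) ∧
    ∀ S, Indep conf S → (∀ p ∈ S, 0 < w p) →
      Indep conf (complete conf S L) ∧ (∀ p ∈ complete conf S L, 0 < w₀ p) ∧
      ∑ p ∈ S, w p + c ≤ ∑ p ∈ complete conf S L, w₀ p

variable {conf : P → P → Prop} {w₀ w : P → ℕ} {L : List P} {v : P}

theorem LocalRatio.nil : LocalRatio conf w w [] :=
  ⟨0, fun _ _ => le_rfl, fun _ hS hw => ⟨hS, hw, le_rfl⟩⟩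

-- The paths that lose weight form a clique, so an independent set loses at most `w v`, whatever
-- truncation does. Conversely the greedy step always gains `w v`: either `S` contains some `q` in
-- conflict with `v`, whose weight was reduced by `w v`, or `v` itself is inserted.
open Classical in
theorem LocalRatio.cons (hrefl : ∀ p, conf p p) (hsymm : ∀ p q, conf p q → conf q p)
    (h : LocalRatio conf w₀ w L) (hv : 0 < w v)
    (hsimp : ∀ q q', 0 < w q → 0 < w q' → conf v q → conf v q' → conf q q') :
    LocalRatio conf w₀ (fun q => w q - if conf v q then w v else 0) (v :: L) := by
  obtain ⟨c, hup, hlow⟩ := h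
  refine ⟨w v + c, fun I hI => (hup I hI).trans ?_, fun S hS hpos => ?_⟩
  · have hJ : (∑ q ∈ I, if 0 < w q ∧ conf v q then w v else 0) ≤ w v := by
      rw [← Finset.sum_filter, Finset.sum_const, smul_eq_mul]
      refine (Nat.mul_le_mul_right _ (Finset.card_le_one.2 fun q hq q' hq' => ?_)).trans_eq
        (one_mul _)
      rw [Finset.mem_filter] at hq hq'
      by_contra hne
      exact hI q hq.1 q' hq'.1 hne (hsimp q q' hq.2.1 hq'.2.1 hq.2.2 hq'.2.2)
    have hsum : ∑ q ∈ I, w q ≤ ∑ q ∈ I, ((w q - if conf v q then w v else 0) +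
        if 0 < w q ∧ conf v q then w v else 0) := by
      refine Finset.sum_le_sum fun q _ => ?_
      by_cases h1 : conf v q <;> by_cases h2 : 0 < w q <;> simp [h1, h2] <;> omega
    rw [Finset.sum_add_distrib] at hsum
    beta_reduce
    omega
  · have hw : ∀ p ∈ S, 0 < w p := fun p hp => (hpos p hp).trans_le (Nat.sub_le _ _)
    have hle : ∑ p ∈ S, (w p - if conf v p then w v else 0) ≤ ∑ p ∈ S, w p :=
      Finset.sum_le_sum fun p _ => Nat.sub_le _ _
    rw [complete]
    beta_reduce at hpos ⊢
    split_ifs with hc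
    · obtain ⟨h1, h2, h3⟩ := hlow S hS hw
      refine ⟨h1, h2, le_trans ?_ h3⟩
      obtain ⟨q, hq, hvq⟩ := hc
      -- The residual weight of `q` is positive, so the subtraction at `q` was not truncated.
      have hq' := hpos q hq
      rw [if_pos hvq] at hq'
      rw [← Finset.add_sum_erase _ _ hq, ← Finset.add_sum_erase _ w hq, if_pos hvq]
      have : ∑ p ∈ S.erase q, (w p - if conf v p then w v else 0) ≤ ∑ p ∈ S.erase q, w p :=
        Finset.sum_le_sum fun p _ => Nat.sub_le _ _
      omega
    · have hvS : v ∉ S := fun hvS => hc ⟨v, hvS, hrefl v⟩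
      push Not at hc
      obtain ⟨h1, h2, h3⟩ := hlow (insert v S)
        (by
          intro p hp q hq hne
          rw [Finset.mem_insert] at hp hq
          rcases hp with rfl | hp <;> rcases hq with rfl | hq
          · exact absurd rfl hne
          · exact hc q hq
          · exact fun h => hc p hp (hsymm _ _ h)
          · exact hS p hp q hq hne)
        (by
          intro p hp
          rw [Finset.mem_insert] at hp
          rcases hp with rfl | hp
          exacts [hv, hw p hp])
      rw [Finset.sum_insert hvS] at h3
      exact ⟨h1, h2, by omega⟩

/-- Once no weight is left, the greedy selection is a maximum weight independent set. -/
theorem LocalRatio.optimal (h : LocalRatio conf w₀ w L) (hw : ∀ p, w p = 0) :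
    Indep conf (complete conf ∅ L) ∧ (∀ p ∈ complete conf ∅ L, 0 < w₀ p) ∧
      ∀ I, Indep conf I → ∑ p ∈ I, w₀ p ≤ ∑ p ∈ complete conf ∅ L, w₀ p := by
  obtain ⟨c, hup, hlow⟩ := h
  obtain ⟨h1, h2, h3⟩ := hlow ∅ (by simp [Indep]) (by simp)
  refine ⟨h1, h2, fun I hI => (hup I hI).trans ?_⟩
  simpa [hw] using h3

end

/-! ### Components of edge open packings in proper interval graphs -/

section
variable {V : Type*} {G : SimpleGraph V}

open Classical in
/-- The number of edges of the induced path with the end vertices `p.1`, `p.2.2` and the inner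
vertex `p.2.1`; the two end vertices may coincide.  It is `0` if `p` is not such a path. -/
noncomputable def pathWeight (G : SimpleGraph V) (p : V × V × V) : ℕ :=
  if G.Adj p.1 p.2.1 ∧ G.Adj p.2.2 p.2.1 ∧ ¬ G.Adj p.1 p.2.2 then
    if p.1 = p.2.2 then 1 else 2 else 0

/-- `x` is on the path `p` or adjacent to a vertex of it. -/
def Touches (G : SimpleGraph V) (x : V) (p : V × V × V) : Prop :=
  Near G x p.1 ∨ Near G x p.2.1 ∨ Near G x p.2.2

/-- The paths `p` and `q` have a common vertex or are joined by an edge. -/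
def Conflict (G : SimpleGraph V) (p q : V × V × V) : Prop :=
  Touches G p.1 q ∨ Touches G p.2.1 q ∨ Touches G p.2.2 q

/-- The edges of the path `p`. -/
def pathEdges [DecidableEq V] (p : V × V × V) : Finset (Sym2 V) :=
  {s(p.1, p.2.1), s(p.2.2, p.2.1)}

theorem conflict_iff {p q : V × V × V} : Conflict G p q ↔
    ∃ x y, (x = p.1 ∨ x = p.2.1 ∨ x = p.2.2) ∧ (y = q.1 ∨ y = q.2.1 ∨ y = q.2.2) ∧
      Near G x y := by
  simp only [Conflict, Touches, or_and_right, exists_or, exists_and_left, exists_eq_left]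

theorem conflict_refl (p : V × V × V) : Conflict G p p := .inl (.inl (.inl rfl))

theorem Conflict.symm {p q : V × V × V} (h : Conflict G p q) : Conflict G q p := by
  rw [conflict_iff] at h ⊢
  obtain ⟨x, y, hx, hy, h⟩ := h
  exact ⟨y, x, hy, hx, h.symm⟩

theorem pathWeight_pos {p : V × V × V} :
    0 < pathWeight G p ↔ G.Adj p.1 p.2.1 ∧ G.Adj p.2.2 p.2.1 ∧ ¬ G.Adj p.1 p.2.2 := by
  unfold pathWeight
  split_ifs <;> simp_all

theorem pathWeight_eq_card [DecidableEq V] {p : V × V × V} (h : 0 < pathWeight G p) :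
    pathWeight G p = (pathEdges p).card := by
  rw [pathWeight_pos] at h
  rw [pathWeight, if_pos h, pathEdges, card_pair_edges (G.ne_of_adj h.2.1)]
  split_ifs <;> rfl

theorem eq_of_mem_pathEdges [DecidableEq V] {p : V × V × V} {e : Sym2 V} (he : e ∈ pathEdges p)
    {x : V} (hx : x ∈ e) : x = p.1 ∨ x = p.2.1 ∨ x = p.2.2 := by
  simp only [pathEdges, Finset.mem_insert, Finset.mem_singleton] at he
  rcases he with rfl | rfl <;> rw [Sym2.mem_iff] at hx <;> tauto

theorem exists_mem_pathEdges [DecidableEq V] {p : V × V × V} {x : V}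
    (hx : x = p.1 ∨ x = p.2.1 ∨ x = p.2.2) : ∃ e ∈ pathEdges p, x ∈ e := by
  rcases hx with rfl | rfl | rfl
  exacts [⟨s(p.1, p.2.1), by simp [pathEdges], by simp⟩,
    ⟨s(p.1, p.2.1), by simp [pathEdges], by simp⟩,
    ⟨s(p.2.2, p.2.1), by simp [pathEdges], by simp⟩]

/-- Induced paths without conflicts form an edge open packing. -/
theorem Indep.isEOP [DecidableEq V] {S : Finset (V × V × V)} (hS : Indep (Conflict G) S)
    (hpos : ∀ p ∈ S, 0 < pathWeight G p) :
    IsEOP G (S.biUnion pathEdges) ∧ (S.biUnion pathEdges).card = ∑ p ∈ S, pathWeight G p := by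
  induction S using Finset.induction with
  | empty => exact ⟨isEOP_empty, rfl⟩
  | insert p S hp ih =>
    obtain ⟨h1, h2⟩ := ih (fun a ha b hb => hS a (Finset.mem_insert_of_mem ha) b
      (Finset.mem_insert_of_mem hb)) fun a ha => hpos a (Finset.mem_insert_of_mem ha)
    have hp' := hpos p (Finset.mem_insert_self _ _)
    have hn : ∀ e ∈ pathEdges p, ∀ e' ∈ S.biUnion pathEdges, ∀ x ∈ e, ∀ y ∈ e',
        ¬ Near G x y := by
      intro e he e' he' x hx y hy hxy
      obtain ⟨q, hq, he'⟩ := Finset.mem_biUnion.1 he'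
      exact hS p (Finset.mem_insert_self _ _) q (Finset.mem_insert_of_mem hq)
        (by rintro rfl; exact hp hq) (conflict_iff.2
          ⟨x, y, eq_of_mem_pathEdges he hx, eq_of_mem_pathEdges he' hy, hxy⟩)
    have hpw := pathWeight_pos.1 hp'
    rw [Finset.biUnion_insert, Finset.sum_insert hp, pathWeight_eq_card hp', ← h2,
      Finset.card_union_of_disjoint (disjoint_of_not_near hn)]
    exact ⟨(isEOP_pair hpw.1 hpw.2.1 hpw.2.2).union h1 hn, rfl⟩

/-- `lo` and `hi` are the endpoints of intervals representing `G`. -/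
def IsIntervalModel (G : SimpleGraph V) (lo hi : V → ℝ) : Prop :=
  (∀ v, lo v ≤ hi v) ∧ ∀ u w, Near G u w ↔ lo u ≤ hi w ∧ lo w ≤ hi u

theorem IsProperIntervalGraph.exists_model (h : IsProperIntervalGraph G) :
    ∃ lo hi : V → ℝ, IsIntervalModel G lo hi ∧ ∀ u w, lo w ≤ lo u → hi u ≤ hi w →
      lo w = lo u ∧ hi u = hi w := by
  obtain ⟨a, b, hab, hadj, hprop⟩ := h
  refine ⟨a, b, ⟨hab, fun u w => ?_⟩, fun u w h1 h2 => ?_⟩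
  · rw [Near, hadj, Set.Icc_inter_Icc, Set.nonempty_Icc]
    simp only [max_le_iff, le_min_iff]
    constructor
    · rintro (rfl | ⟨-, h⟩)
      exacts [⟨hab u, hab u⟩, ⟨h.2.1, h.1.2⟩]
    · rintro ⟨h1, h2⟩
      by_cases hne : u = w
      exacts [.inl hne, .inr ⟨hne, ⟨hab u, h2⟩, h1, hab w⟩]
  · have hsub : Set.Icc (a u) (b u) ⊆ Set.Icc (a w) (b w) := Set.Icc_subset_Icc h1 h2
    have heq := (hsub.eq_or_ssubset).resolve_right (hprop u w)
    have h3 : a w ∈ Set.Icc (a u) (b u) := heq ▸ Set.left_mem_Icc.2 (hab w)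
    have h4 : b w ∈ Set.Icc (a u) (b u) := heq ▸ Set.right_mem_Icc.2 (hab w)
    exact ⟨le_antisymm h1 h3.1, le_antisymm h2 h4.2⟩

/-- Proper interval graphs contain no induced claw. -/
theorem IsProperIntervalGraph.claw_free (h : IsProperIntervalGraph G) {a b c d : V}
    (hab : G.Adj a b) (hcb : G.Adj c b) (hdb : G.Adj d b) (hac : ¬ Near G a c)
    (hcd : ¬ Near G c d) (had : ¬ Near G a d) : False := by
  obtain ⟨lo, hi, ⟨hle, hnear⟩, hprop⟩ := h.exists_model
  have h1 := (hnear a b).1 (.inr hab)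
  have h2 := (hnear c b).1 (.inr hcb)
  have h3 := (hnear d b).1 (.inr hdb)
  rw [hnear, not_and_or, not_le, not_le] at hac hcd had
  have ha := hle a
  have hc := hle c
  have hd := hle d
  -- Of three pairwise disjoint intervals that meet the interval of `b`, the middle one lies
  -- strictly inside it. Of the eight sign patterns below, two are cyclic and contradictory.
  have mid : ∀ x, lo b < lo x → hi x < hi b → False := fun x hx hx' =>
    hx.ne (hprop x b hx.le hx'.le).1
  rcases hac with hac | hac <;> rcases hcd with hcd | hcd <;> rcases had with had | had
  · exact mid c (by linarith) (by linarith)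
  · exact mid c (by linarith) (by linarith)
  · exact mid d (by linarith) (by linarith)
  · exact mid a (by linarith) (by linarith)
  · exact mid a (by linarith) (by linarith)
  · exact mid d (by linarith) (by linarith)
  · exact mid c (by linarith) (by linarith)
  · exact mid c (by linarith) (by linarith)

/-- Every edge of an edge open packing of a proper interval graph is on a path that is a component
of the packing. -/
theorem IsEOP.exists_isolated [DecidableEq V] (hG : IsProperIntervalGraph G)
    {D : Finset (Sym2 V)} (hD : IsEOP G D) (hne : D.Nonempty) :
    ∃ p : V × V × V, 0 < pathWeight G p ∧ pathEdges p ⊆ D ∧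
      ∀ e ∈ pathEdges p, ∀ f ∈ D, ∀ x ∈ e, x ∈ f → f ∈ pathEdges p := by
  -- Further edges at the ends are excluded by `IsEOP.eq_of_mem`, and a third edge at the middle
  -- vertex would complete a claw.
  have two : ∀ a b c, s(a, b) ∈ D → s(c, b) ∈ D → a ≠ c → ∃ p : V × V × V, 0 < pathWeight G p ∧
      pathEdges p ⊆ D ∧ ∀ e ∈ pathEdges p, ∀ f ∈ D, ∀ x ∈ e, x ∈ f → f ∈ pathEdges p := by
    intro a b c hab hcb hac
    refine ⟨(a, b, c), pathWeight_pos.2 ⟨hD.1 hab, hD.1 hcb, hD.not_adj hab hcb⟩,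
      by simp [pathEdges, Finset.insert_subset_iff, hab, hcb], fun e he f hf x hx hxf => ?_⟩
    rcases eq_of_mem_pathEdges he hx with rfl | rfl | rfl
    · simp [pathEdges, hD.eq_of_mem hab hcb hac hf hxf]
    · obtain ⟨d, rfl⟩ := Sym2.mem_iff_exists.1 hxf
      rw [Sym2.eq_swap] at hf ⊢
      by_contra hdp
      simp only [pathEdges, Finset.mem_insert, Finset.mem_singleton, not_or] at hdp
      refine hG.claw_free (hD.1 hab) (hD.1 hcb) (hD.1 hf) ?_ ?_ ?_
      · exact not_or.2 ⟨hac, hD.not_adj hab hcb⟩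
      · exact not_or.2 ⟨by rintro rfl; exact hdp.2 rfl, hD.not_adj hcb hf⟩
      · exact not_or.2 ⟨by rintro rfl; exact hdp.1 rfl, hD.not_adj hab hf⟩
    · simp [pathEdges, hD.eq_of_mem hcb hab hac.symm hf hxf]
  obtain ⟨e, he⟩ := hne
  by_cases hiso : ∀ f ∈ D, ∀ x ∈ e, x ∈ f → f = e
  · induction e with
    | h a b =>
      refine ⟨(a, b, a), pathWeight_pos.2 ⟨hD.1 he, hD.1 he, G.loopless.irrefl _⟩, ?_, ?_⟩
      · simp [pathEdges, he]
      · intro e he f hf x hx hxf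
        simp only [pathEdges, Finset.pair_eq_singleton, Finset.mem_singleton] at he ⊢
        subst he
        exact hiso f hf x hx hxf
  · push Not at hiso
    obtain ⟨f, hf, b, hbe, hbf, hne⟩ := hiso
    obtain ⟨a, rfl⟩ := Sym2.mem_iff_exists.1 hbe
    obtain ⟨c, rfl⟩ := Sym2.mem_iff_exists.1 hbf
    refine two a b c (Sym2.eq_swap ▸ he) (Sym2.eq_swap ▸ hf) ?_
    rintro rfl
    exact hne rfl

/-- Components are peeled off one at a time; an isolated path is near no remaining edge, hence in
conflict with no later path. With `Indep.isEOP` this identifies the packing number with the maximum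
weight of an independent set of paths. -/
theorem IsEOP.exists_indep [DecidableEq V] (hG : IsProperIntervalGraph G)
    {D : Finset (Sym2 V)} (hD : IsEOP G D) :
    ∃ I : Finset (V × V × V), Indep (Conflict G) I ∧ (∀ p ∈ I, pathEdges p ⊆ D) ∧
      D.card = ∑ p ∈ I, pathWeight G p := by
  induction D using Finset.strongInduction with
  | H D ih =>
    rcases D.eq_empty_or_nonempty with rfl | hne
    · exact ⟨∅, by simp [Indep], by simp, by simp⟩
    obtain ⟨p, hp, hpD, hiso⟩ := hD.exists_isolated hG hne
    have hpn : (pathEdges p).Nonempty := ⟨s(p.1, p.2.1), by simp [pathEdges]⟩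
    obtain ⟨I, hI, hID, hcard⟩ := ih (D \ pathEdges p) (Finset.sdiff_ssubset hpD hpn)
      (hD.mono Finset.sdiff_subset)
    have hn : ∀ q ∈ I, ¬ Conflict G p q := by
      intro q hq hpq
      obtain ⟨x, y, hx, hy, hxy⟩ := conflict_iff.1 hpq
      obtain ⟨e, he, hx⟩ := exists_mem_pathEdges hx
      obtain ⟨f, hf, hy⟩ := exists_mem_pathEdges hy
      have hf := Finset.mem_sdiff.1 (hID q hq hf)
      exact hD.not_near hpD hiso he hf.1 hf.2 hx hy hxy
    have hpI : p ∉ I := fun h => hn p h (conflict_refl p)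
    refine ⟨insert p I, ?_, ?_, ?_⟩
    · intro a ha b hb hne
      rw [Finset.mem_insert] at ha hb
      rcases ha with rfl | ha <;> rcases hb with rfl | hb
      · exact absurd rfl hne
      · exact hn b hb
      · exact fun h => hn a ha h.symm
      · exact hI a ha b hb hne
    · intro a ha
      rw [Finset.mem_insert] at ha
      rcases ha with rfl | ha
      exacts [hpD, (hID a ha).trans Finset.sdiff_subset]
    · rw [Finset.sum_insert hpI, ← hcard, pathWeight_eq_card hp, add_comm,
        Finset.card_sdiff_add_card_eq_card hpD]

/-- Among finitely many induced paths of an interval graph, the one that ends first is simplicial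
in the conflict graph. -/
theorem IsIntervalModel.exists_simplicial {lo hi : V → ℝ} (h : IsIntervalModel G lo hi)
    {S : Finset (V × V × V)} (hS : S.Nonempty) (hpos : ∀ p ∈ S, 0 < pathWeight G p) :
    ∃ v ∈ S, ∀ q ∈ S, ∀ q' ∈ S, Conflict G v q → Conflict G v q' → Conflict G q q' := by
  obtain ⟨hle, hnear⟩ := h
  set R : V × V × V → ℝ := fun p => max (hi p.1) (max (hi p.2.1) (hi p.2.2)) with hR
  obtain ⟨v, hv, hmin⟩ := S.exists_min_image R hS
  have hhi : ∀ p : V × V × V, ∀ x, (x = p.1 ∨ x = p.2.1 ∨ x = p.2.2) → hi x ≤ R p := by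
    rintro p x (rfl | rfl | rfl) <;> simp [hR]
  have hmid : ∀ q ∈ S, ∀ x, (x = q.1 ∨ x = q.2.1 ∨ x = q.2.2) → Near G x q.2.1 := by
    intro q hq x hx
    have := pathWeight_pos.1 (hpos q hq)
    rcases hx with rfl | rfl | rfl
    exacts [.inr this.1, .inl rfl, .inr this.2.1]
  -- every path in conflict with `v` has an interval that contains the point `R v`
  have key : ∀ q ∈ S, Conflict G v q → ∃ y, (y = q.1 ∨ y = q.2.1 ∨ y = q.2.2) ∧
      lo y ≤ R v ∧ R v ≤ hi y := by
    intro q hq hvq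
    obtain ⟨x, y, hx, hy, hxy⟩ := conflict_iff.1 hvq
    have h1 : lo y ≤ R v := ((hnear x y).1 hxy).2.trans (hhi v x hx)
    -- If `y` ends before `R v`, some vertex of `q` still reaches `R v` by the minimality of `v`. As
    -- `q` is held together by its middle vertex, either that vertex or a neighbour of it on `q` has
    -- an interval containing `R v`.
    by_cases h2 : R v ≤ hi y
    · exact ⟨y, hy, h1, h2⟩
    have h3 : lo q.2.1 ≤ R v := by
      have := ((hnear y q.2.1).1 (hmid q hq y hy)).2
      linarith
    by_cases h4 : R v ≤ hi q.2.1
    · exact ⟨q.2.1, by simp, h3, h4⟩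
    obtain ⟨z, hz, hRz⟩ : ∃ z, (z = q.1 ∨ z = q.2.1 ∨ z = q.2.2) ∧ R v ≤ hi z := by
      have : R v ≤ max (hi q.1) (max (hi q.2.1) (hi q.2.2)) := hmin q hq
      rw [le_max_iff, le_max_iff] at this
      rcases this with h | h | h
      exacts [⟨_, .inl rfl, h⟩, ⟨_, .inr (.inl rfl), h⟩, ⟨_, .inr (.inr rfl), h⟩]
    have := ((hnear z q.2.1).1 (hmid q hq z hz)).1
    exact ⟨z, hz, by linarith, hRz⟩
  refine ⟨v, hv, fun q hq q' hq' hvq hvq' => ?_⟩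
  obtain ⟨y, hy, h1, h2⟩ := key q hq hvq
  obtain ⟨y', hy', h1', h2'⟩ := key q' hq' hvq'
  exact conflict_iff.2 ⟨y, y', hy, hy', (hnear y y').2 ⟨h1.trans h2', h1'.trans h2⟩⟩

end

end EdgeOpenPacking

namespace EdgeOpenPacking

open RAM

/-! ### The algorithm

The memory holds the adjacency matrix at the addresses `1 + (a * n + b)`, and above `2 * n ^ 2`
eight interleaved arrays, of which six are used: the amounts by which the weights of the paths have
been reduced (`0`), flags for the directed edges chosen (`1`), the height of the stack and the
length of the output (`2`), and the stack of the paths processed (`3`, `4`, `5`). -/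

/-- The address of the cell `x` of the array `j`. -/
def addr (n j x : ℕ) : ℕ := 2 * (n * n) + 1 + (8 * x + j)

/-- The position of the pair `(a, b)` in an array. -/
def pairIdx (n a b : ℕ) : ℕ := a * n + b

/-- The position of the triple `(a, b, c)` in an array. -/
def tripleIdx (n a b c : ℕ) : ℕ := pairIdx n (pairIdx n a b) c

def AdjMem (n : ℕ) (m : ℕ → ℕ) (a b : ℕ) : Prop := 0 < m (1 + pairIdx n a b)

def NearMem (n : ℕ) (m : ℕ → ℕ) (a b : ℕ) : Prop := a = b ∨ AdjMem n m a b

def PathMem (n : ℕ) (m : ℕ → ℕ) (a b c : ℕ) : Prop :=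
  AdjMem n m a b ∧ AdjMem n m c b ∧ ¬ AdjMem n m a c

def TouchesMem (n : ℕ) (m : ℕ → ℕ) (x a b c : ℕ) : Prop :=
  NearMem n m x a ∨ NearMem n m x b ∨ NearMem n m x c

def ConflictMem (n : ℕ) (m : ℕ → ℕ) (a b c a' b' c' : ℕ) : Prop :=
  TouchesMem n m a a' b' c' ∨ TouchesMem n m b a' b' c' ∨ TouchesMem n m c a' b' c'

open Classical in
/-- The weight of a path that has not been subtracted yet. -/
noncomputable def restMem (n : ℕ) (m : ℕ → ℕ) (a b c : ℕ) : ℕ :=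
  (if PathMem n m a b c then 1 else 0) + (if PathMem n m a b c ∧ ¬ a = c then 1 else 0) -
    m (addr n 0 (tripleIdx n a b c))

/-- The path has positive weight, and the paths of positive weight in conflict with it are pairwise
in conflict. -/
def SimplicialMem (n : ℕ) (m : ℕ → ℕ) (a b c : ℕ) : Prop :=
  0 < restMem n m a b c ∧ ∀ a' < n, ∀ b' < n, ∀ c' < n, ∀ a'' < n, ∀ b'' < n, ∀ c'' < n,
    0 < restMem n m a' b' c' → 0 < restMem n m a'' b'' c'' →
    ConflictMem n m a b c a' b' c' → ConflictMem n m a b c a'' b'' c'' →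
    ConflictMem n m a' b' c' a'' b'' c''

open Classical in
/-- Subtract `w` from the weights of the paths in conflict with `(a, b, c)`. -/
noncomputable def subtractMem (n w a b c : ℕ) (m : ℕ → ℕ) : ℕ → ℕ :=
  forN n (fun a' => forN n fun b' => forN n fun c' m =>
    if ConflictMem n m a b c a' b' c' then
      Function.update m (addr n 0 (tripleIdx n a' b' c')) (m (addr n 0 (tripleIdx n a' b' c')) + w)
    else m) m

def storeAt (i : (ℕ → ℕ) → ℕ) (x : (ℕ → ℕ) → ℕ) (m : ℕ → ℕ) : ℕ → ℕ :=
  Function.update m (i m) (x m)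

/-- Put `(a, b, c)` on the stack. -/
def pushMem (n a b c : ℕ) (m : ℕ → ℕ) : ℕ → ℕ :=
  storeAt (fun _ => addr n 2 0) (fun m => m (addr n 2 0) + 1)
    (storeAt (fun m => addr n 5 (m (addr n 2 0))) (fun _ => c)
      (storeAt (fun m => addr n 4 (m (addr n 2 0))) (fun _ => b)
        (storeAt (fun m => addr n 3 (m (addr n 2 0))) (fun _ => a) m)))

open Classical in
/-- Process the path `(a, b, c)`. -/
noncomputable def stepMem (n a b c : ℕ) (m : ℕ → ℕ) : ℕ → ℕ :=
  if SimplicialMem n m a b c then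
    pushMem n a b c (subtractMem n (restMem n m a b c) a b c m)
  else m

/-- Process all paths once. -/
noncomputable def sweepMem (n : ℕ) (m : ℕ → ℕ) : ℕ → ℕ :=
  forN n (fun a => forN n fun b => forN n fun c => stepMem n a b c) m

/-- Some chosen edge has an endpoint on or next to the path `(a, b, c)`. -/
def BlockedMem (n : ℕ) (m : ℕ → ℕ) (a b c : ℕ) : Prop :=
  ∃ x < n, ∃ y < n, 0 < m (addr n 1 (pairIdx n x y)) ∧
    (TouchesMem n m x a b c ∨ TouchesMem n m y a b c)

open Classical in
/-- Choose the edges of the path `(a, b, c)` unless it is blocked. -/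
noncomputable def chooseMem (n a b c : ℕ) (m : ℕ → ℕ) : ℕ → ℕ :=
  if BlockedMem n m a b c then m else
    storeAt (fun _ => addr n 1 (pairIdx n c b)) (fun _ => 1)
      (storeAt (fun _ => addr n 1 (pairIdx n a b)) (fun _ => 1) m)

/-- Take the path on top of the stack. -/
noncomputable def takeMem (n : ℕ) (m : ℕ → ℕ) : ℕ → ℕ :=
  chooseMem n (m (addr n 3 (m (addr n 2 0)))) (m (addr n 4 (m (addr n 2 0))))
    (m (addr n 5 (m (addr n 2 0)))) m

open Classical in
noncomputable def popMem (n : ℕ) (m : ℕ → ℕ) : ℕ → ℕ :=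
  if 0 < m (addr n 2 0) then
    takeMem n (storeAt (fun _ => addr n 2 0) (fun m => m (addr n 2 0) - 1) m)
  else m

/-- Flags are directed from an end of a path to its middle vertex, so both directions are tested; `x
< y` makes each edge appear once. -/
def EdgeMem (n : ℕ) (m : ℕ → ℕ) (x y : ℕ) : Prop :=
  x < y ∧ (0 < m (addr n 1 (pairIdx n x y)) ∨ 0 < m (addr n 1 (pairIdx n y x)))

open Classical in
/-- Write the edge `xy` to the output if it is chosen. -/
noncomputable def emitMem (n x y : ℕ) (m : ℕ → ℕ) : ℕ → ℕ :=
  if EdgeMem n m x y then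
    storeAt (fun _ => addr n 2 1) (fun m => m (addr n 2 1) + 2)
      (storeAt (fun m => m (addr n 2 1) + 1) (fun _ => y)
        (storeAt (fun m => m (addr n 2 1)) (fun _ => x) m))
  else m

/-- `n ^ 3` sweeps suffice: each one exhausts at least one of the at most `n ^ 3` paths of positive
weight, as long as there are any. -/
noncomputable def reduceAll (n : ℕ) (m : ℕ → ℕ) : ℕ → ℕ :=
  forN n (fun _ => forN n fun _ => forN n fun _ => sweepMem n) m

/-- The stack never exceeds `n ^ 3` entries, and popping an empty stack does nothing. -/
noncomputable def popAll (n : ℕ) (m : ℕ → ℕ) : ℕ → ℕ :=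
  forN n (fun _ => forN n fun _ => forN n fun _ => popMem n) m

noncomputable def emitAll (n : ℕ) (m : ℕ → ℕ) : ℕ → ℕ :=
  forN n (fun x => forN n fun y => emitMem n x y) m

/-! #### Its running time -/

section
variable {e a b c a' b' c' x w : ℕ → (ℕ → ℕ) → (ℕ → ℕ) → ℕ}

theorem comp_addr (j : ℕ) (he : EComp e) : EComp fun n v m => addr n j (e n v m) := by
  -- The stride `8` of the interleaved arrays is a power of two, so scaling takes three doublings.
  have h2 := he.add he
  have h4 := h2.add h2
  have h := (((EComp.size.mul_size).add EComp.size.mul_size).add (.const 1)).add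
    ((h4.add h4).add (.const j))
  refine h.congr fun n v m => ?_
  unfold addr
  ring

theorem comp_pairIdx (ha : EComp a) (hb : EComp b) :
    EComp fun n v m => pairIdx n (a n v m) (b n v m) :=
  ha.mul_size.add hb

theorem comp_tripleIdx (ha : EComp a) (hb : EComp b) (hc : EComp c) :
    EComp fun n v m => tripleIdx n (a n v m) (b n v m) (c n v m) :=
  comp_pairIdx (comp_pairIdx ha hb) hc

theorem comp_adj (ha : EComp a) (hb : EComp b) :
    PComp fun n v m => AdjMem n m (a n v m) (b n v m) :=
  .lt (.const 0) (((EComp.const 1).add (comp_pairIdx ha hb)).load)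

theorem comp_near (ha : EComp a) (hb : EComp b) :
    PComp fun n v m => NearMem n m (a n v m) (b n v m) :=
  (PComp.eq ha hb).or (comp_adj ha hb)

theorem comp_touches (hx : EComp x) (ha : EComp a) (hb : EComp b) (hc : EComp c) :
    PComp fun n v m => TouchesMem n m (x n v m) (a n v m) (b n v m) (c n v m) :=
  (comp_near hx ha).or ((comp_near hx hb).or (comp_near hx hc))

theorem comp_conflict (ha : EComp a) (hb : EComp b) (hc : EComp c)
    (ha' : EComp a') (hb' : EComp b') (hc' : EComp c') :
    PComp fun n v m => ConflictMem n m (a n v m) (b n v m) (c n v m)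
      (a' n v m) (b' n v m) (c' n v m) :=
  (comp_touches ha ha' hb' hc').or ((comp_touches hb ha' hb' hc').or (comp_touches hc ha' hb' hc'))

theorem comp_rest (ha : EComp a) (hb : EComp b) (hc : EComp c) :
    EComp fun n v m => restMem n m (a n v m) (b n v m) (c n v m) := by
  have h : PComp fun n v m => PathMem n m (a n v m) (b n v m) (c n v m) :=
    (comp_adj ha hb).and ((comp_adj hc hb).and (comp_adj ha hc).not)
  exact (h.indicator.add (h.and (PComp.eq ha hc).not).indicator).sub
    (comp_addr 0 (comp_tripleIdx ha hb hc)).load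

/-- Variables are de Bruijn indices. Under the six quantifiers the tested path `2, 1, 0` has become
`8, 7, 6`, and the quantified paths are `5, 4, 3` and `2, 1, 0`. -/
theorem comp_simplicial : PComp fun n v m => SimplicialMem n m (v 2) (v 1) (v 0) := by
  have h (i : ℕ) := EComp.var i
  have := (PComp.lt (.const 0) (comp_rest (h 5) (h 4) (h 3))).imp
    ((PComp.lt (.const 0) (comp_rest (h 2) (h 1) (h 0))).imp
    ((comp_conflict (h 8) (h 7) (h 6) (h 5) (h 4) (h 3)).imp
    ((comp_conflict (h 8) (h 7) (h 6) (h 2) (h 1) (h 0)).imp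
    (comp_conflict (h 5) (h 4) (h 3) (h 2) (h 1) (h 0)))))
  exact (PComp.lt (.const 0) (comp_rest (h 2) (h 1) (h 0))).and
    this.forall.forall.forall.forall.forall.forall

theorem comp_subtract :
    CComp fun n v m => subtractMem n (v 0) (v 3) (v 2) (v 1) m := by
  have h (i : ℕ) := EComp.var i
  have hidx := comp_addr 0 (comp_tripleIdx (h 2) (h 1) (h 0))
  exact (CComp.ite (inst := fun _ _ _ => Classical.propDecidable _)
    (comp_conflict (h 6) (h 5) (h 4) (h 2) (h 1) (h 0))
    (.store hidx (hidx.load.add (h 3))) .id).forN.forN.forN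

theorem comp_push : CComp fun n v m => pushMem n (v 2) (v 1) (v 0) m := by
  have h (i : ℕ) := EComp.var i
  have hsp := (comp_addr 2 (.const 0)).load
  exact (CComp.store (comp_addr 3 hsp) (h 2)).seq
    ((CComp.store (comp_addr 4 hsp) (h 1)).seq
    ((CComp.store (comp_addr 5 hsp) (h 0)).seq
    (CComp.store (comp_addr 2 (.const 0)) (hsp.add (.const 1)))))

theorem comp_step : CComp fun n v m => stepMem n (v 2) (v 1) (v 0) m := by
  have h (i : ℕ) := EComp.var i
  exact CComp.ite comp_simplicial
    -- The weight is saved in a variable first, because the subtraction changes a cell from which it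
    -- is computed.
    ((CComp.bind (comp_rest (h 2) (h 1) (h 0)) comp_subtract).seq comp_push) .id

theorem comp_choose : CComp fun n v m => chooseMem n (v 2) (v 1) (v 0) m := by
  have h (i : ℕ) := EComp.var i
  have hb : PComp fun n v m => BlockedMem n m (v 2) (v 1) (v 0) :=
    ((PComp.lt (.const 0) (comp_addr 1 (comp_pairIdx (h 1) (h 0))).load).and
      ((comp_touches (h 1) (h 4) (h 3) (h 2)).or
        (comp_touches (h 0) (h 4) (h 3) (h 2)))).exists.exists
  exact CComp.ite hb .id
    ((CComp.store (comp_addr 1 (comp_pairIdx (h 2) (h 1))) (.const 1)).seq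
    (CComp.store (comp_addr 1 (comp_pairIdx (h 0) (h 1))) (.const 1)))

theorem comp_pop : CComp fun n _ m => popMem n m := by
  have hsp := (comp_addr 2 (.const 0)).load
  exact CComp.ite (PComp.lt (.const 0) hsp)
    ((CComp.store (comp_addr 2 (.const 0)) (hsp.sub (.const 1))).seq
      (CComp.bind (comp_addr 3 hsp).load (CComp.bind (comp_addr 4 hsp).load
        (CComp.bind (comp_addr 5 hsp).load comp_choose)))) .id

theorem comp_emit : CComp fun n v m => emitMem n (v 1) (v 0) m := by
  have h (i : ℕ) := EComp.var i
  have hlen := (comp_addr 2 (.const 1)).load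
  have he : PComp fun n v m => EdgeMem n m (v 1) (v 0) :=
    (PComp.lt (h 1) (h 0)).and
      ((PComp.lt (.const 0) (comp_addr 1 (comp_pairIdx (h 1) (h 0))).load).or
      (PComp.lt (.const 0) (comp_addr 1 (comp_pairIdx (h 0) (h 1))).load))
  exact CComp.ite he
    ((CComp.store hlen (h 1)).seq ((CComp.store (hlen.add (.const 1)) (h 0)).seq
    (CComp.store (comp_addr 2 (.const 1)) (hlen.add (.const 2))))) .id

theorem comp_main : CComp fun n _ m => emitAll n (popAll n (reduceAll n m)) :=
  (comp_step.forN.forN.forN.forN.forN.forN).seq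
    ((comp_pop.forN.forN.forN).seq (comp_emit.forN.forN))

theorem comp_outputLength : EComp fun n _ m => m (addr n 2 1) :=
  (comp_addr 2 (.const 1)).load

end

end EdgeOpenPacking

/-! ### Invariants of counting loops -/

namespace RAM

section
variable {α : Type*} {n : ℕ} {m : α}

theorem forN_induct {f : ℕ → α → α} {I : ℕ → α → Prop}
    (h : ∀ k < n, ∀ m, I k m → I (k + 1) (f k m)) (h0 : I 0 m) : I n (forN n f m) := by
  induction n with
  | zero => exact h0
  | succ n ih => exact h n (Nat.lt_succ_self n) _ (ih fun k hk => h k (hk.trans (Nat.lt_succ_self n)))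

/-- Each pass advances the counter by `s`, so nested loops compose and their numbers of passes
multiply. -/
theorem forN_count {f : ℕ → α → α} {K : ℕ → α → Prop} {s t : ℕ}
    (h : ∀ k < n, ∀ t m, K t m → K (t + s) (f k m)) (h0 : K t m) :
    K (t + n * s) (forN n f m) :=
  forN_induct (I := fun k m => K (t + k * s) m)
    (fun k hk m hm => by rw [Nat.succ_mul, ← add_assoc]; exact h k hk _ _ hm) (by simpa using h0)

theorem forN_preserve {f : ℕ → α → α} {I : α → Prop}
    (h : ∀ k < n, ∀ m, I m → I (f k m)) (h0 : I m) : I (forN n f m) :=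
  forN_induct (I := fun _ => I) h h0

theorem forN_reach {f : ℕ → α → α} {I Q : α → Prop} {k₀ : ℕ} (hk₀ : k₀ < n)
    (hI : ∀ k < n, ∀ m, I m → I (f k m)) (hQ : ∀ k < n, ∀ m, I m → Q m → Q (f k m))
    (h : ∀ m, I m → Q (f k₀ m)) (h0 : I m) : Q (forN n f m) := by
  refine (forN_induct (I := fun k m => I m ∧ (k₀ < k → Q m)) (fun k hk m hm => ⟨hI k hk m hm.1,
    fun hlt => ?_⟩) ⟨h0, fun h => absurd h (Nat.not_lt_zero _)⟩).2 hk₀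
  rcases Nat.lt_succ_iff_lt_or_eq.1 hlt with hlt | rfl
  exacts [hQ k hk m hm.1 (hm.2 hlt), h m hm.1]

open Classical in
/-- Add `w` to the memory cells in `R`. -/
noncomputable def increase (w : ℕ) (R : ℕ → Prop) (m : ℕ → ℕ) : ℕ → ℕ :=
  fun x => if R x then m x + w else m x

/-- A loop whose passes increase disjoint sets of memory cells. -/
theorem forN_increase {n w : ℕ} {f : ℕ → (ℕ → ℕ) → (ℕ → ℕ)} {R : ℕ → ℕ → Prop}
    {I : (ℕ → ℕ) → Prop}
    (hf : ∀ k < n, ∀ m, I m → f k m = increase w (R k) m ∧ I (f k m))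
    (hR : ∀ k k' x, R k x → R k' x → k = k') {m : ℕ → ℕ} (h0 : I m) :
    forN n f m = increase w (fun x => ∃ k < n, R k x) m ∧ I (forN n f m) := by
  refine forN_induct (I := fun k m' => m' = increase w (fun x => ∃ j < k, R j x) m ∧
    I m') (fun k hk m' hm' => ?_) ⟨by funext x; simp [increase], h0⟩
  obtain ⟨h1, h2⟩ := hf k hk m' hm'.2
  refine ⟨?_, h2⟩
  rw [h1, hm'.1]
  funext x
  by_cases hx : R k x
  · have h1 : ¬ ∃ j < k, R j x := fun ⟨j, hj, hjx⟩ => hj.ne (hR _ _ _ hjx hx)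
    have h2 : ∃ j < k + 1, R j x := ⟨k, Nat.lt_succ_self k, hx⟩
    simp only [increase, hx, h1, h2, if_true, if_false]
  · have h2 : (∃ j < k + 1, R j x) ↔ ∃ j < k, R j x := by
      constructor
      · rintro ⟨j, hj, hjx⟩
        refine ⟨j, lt_of_le_of_ne (Nat.lt_succ_iff.1 hj) ?_, hjx⟩
        rintro rfl
        exact hx hjx
      · rintro ⟨j, hj, hjx⟩
        exact ⟨j, hj.trans (Nat.lt_succ_self k), hjx⟩
    simp only [increase, hx, if_false]
    by_cases h3 : ∃ j < k, R j x
    · rw [if_pos h3, if_pos (h2.2 h3)]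
    · rw [if_neg h3, if_neg (h2.not.2 h3)]

end

end RAM

namespace EdgeOpenPacking

open RAM

/-! #### Its correctness -/

theorem addr_inj {n i j x y : ℕ} (hi : i < 8) (hj : j < 8) :
    addr n i x = addr n j y ↔ i = j ∧ x = y := by
  unfold addr
  generalize n * n = N
  omega

theorem pairIdx_lt {n a b : ℕ} (ha : a < n) (hb : b < n) : pairIdx n a b < n * n := by
  have := Nat.mul_le_mul_right n (Nat.succ_le_of_lt ha)
  rw [Nat.succ_mul] at this
  unfold pairIdx
  omega

theorem pairIdx_inj {n a b a' b' : ℕ} (hb : b < n) (hb' : b' < n) :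
    pairIdx n a b = pairIdx n a' b' ↔ a = a' ∧ b = b' := by
  refine ⟨fun h => ?_, fun h => by rw [h.1, h.2]⟩
  unfold pairIdx at h
  have hn : 0 < n := by omega
  have h1 : (a * n + b) / n = (a' * n + b') / n := by rw [h]
  have h2 : (a * n + b) % n = (a' * n + b') % n := by rw [h]
  rw [mul_comm a, mul_comm a', Nat.mul_add_div hn, Nat.mul_add_div hn, Nat.div_eq_of_lt hb,
    Nat.div_eq_of_lt hb'] at h1
  rw [mul_comm a, mul_comm a', Nat.mul_add_mod, Nat.mul_add_mod, Nat.mod_eq_of_lt hb,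
    Nat.mod_eq_of_lt hb'] at h2
  omega

theorem tripleIdx_inj {n : ℕ} {p q : Fin n × Fin n × Fin n} :
    tripleIdx n p.1 p.2.1 p.2.2 = tripleIdx n q.1 q.2.1 q.2.2 ↔ p = q := by
  rw [tripleIdx, tripleIdx, pairIdx_inj p.2.2.2 q.2.2.2, pairIdx_inj p.2.1.2 q.2.1.2,
    Prod.ext_iff, Prod.ext_iff, Fin.ext_iff, Fin.ext_iff, Fin.ext_iff, and_assoc]

section
variable {n : ℕ} {G : SimpleGraph (Fin n)} {m m' : ℕ → ℕ}

/-- The memory `m` holds the adjacency matrix of `G`. -/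
def HoldsGraph (G : SimpleGraph (Fin n)) (m : ℕ → ℕ) : Prop :=
  ∀ a b : Fin n, AdjMem n m a b ↔ G.Adj a b

theorem HoldsGraph.congr (h : HoldsGraph G m) (hm : ∀ x < addr n 0 0, m' x = m x) :
    HoldsGraph G m' := fun a b => by
  rw [← h a b, AdjMem, AdjMem, hm]
  have := pairIdx_lt a.2 b.2
  unfold addr
  omega

theorem HoldsGraph.near (h : HoldsGraph G m) (a b : Fin n) :
    NearMem n m a b ↔ Near G a b := by
  rw [NearMem, Near, h a b, Fin.ext_iff]

theorem HoldsGraph.touches (h : HoldsGraph G m) (x : Fin n) (p : Fin n × Fin n × Fin n) :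
    TouchesMem n m x p.1 p.2.1 p.2.2 ↔ Touches G x p := by
  simp only [TouchesMem, Touches, h.near]

theorem HoldsGraph.conflict (h : HoldsGraph G m) (p q : Fin n × Fin n × Fin n) :
    ConflictMem n m p.1 p.2.1 p.2.2 q.1 q.2.1 q.2.2 ↔ Conflict G p q := by
  simp only [ConflictMem, Conflict, h.touches]

/-- The weight of the path `p` that has not been subtracted yet. -/
noncomputable def rest (n : ℕ) (m : ℕ → ℕ) (p : Fin n × Fin n × Fin n) : ℕ :=
  restMem n m p.1 p.2.1 p.2.2

theorem HoldsGraph.rest_eq (h : HoldsGraph G m) (p : Fin n × Fin n × Fin n) :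
    rest n m p = pathWeight G p - m (addr n 0 (tripleIdx n p.1 p.2.1 p.2.2)) := by
  rw [rest, restMem, pathWeight]
  have hP : PathMem n m p.1 p.2.1 p.2.2 ↔
      G.Adj p.1 p.2.1 ∧ G.Adj p.2.2 p.2.1 ∧ ¬ G.Adj p.1 p.2.2 := by
    rw [PathMem, h p.1 p.2.1, h p.2.2 p.2.1, h p.1 p.2.2]
  congr 1
  by_cases h1 : PathMem n m p.1 p.2.1 p.2.2
  · rw [if_pos h1, if_pos (hP.1 h1)]
    by_cases h2 : p.1 = p.2.2 <;> simp [h1, h2, ← Fin.ext_iff]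
  · rw [if_neg h1, if_neg (hP.not.1 h1), if_neg fun h => h1 h.1]

theorem HoldsGraph.simplicial (h : HoldsGraph G m) (v : Fin n × Fin n × Fin n) :
    SimplicialMem n m v.1 v.2.1 v.2.2 ↔ 0 < rest n m v ∧ ∀ q q', 0 < rest n m q →
      0 < rest n m q' → Conflict G v q → Conflict G v q' → Conflict G q q' := by
  refine and_congr_right fun _ => ⟨fun H q q' => ?_, fun H a ha b hb c hc a' ha' b' hb' c' hc' => ?_⟩
  · have := H q.1 q.1.2 q.2.1 q.2.1.2 q.2.2 q.2.2.2 q'.1 q'.1.2 q'.2.1 q'.2.1.2 q'.2.2 q'.2.2.2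
    rwa [h.conflict, h.conflict, h.conflict] at this
  · have := H (⟨a, ha⟩, ⟨b, hb⟩, ⟨c, hc⟩) (⟨a', ha'⟩, ⟨b', hb'⟩, ⟨c', hc'⟩)
    rwa [← h.conflict, ← h.conflict, ← h.conflict] at this

/-- Distinct triples own distinct cells, so each cell is increased at most once. The conflict test
is evaluated on the changing memory, which still holds the same graph because only array cells are
written. -/
theorem HoldsGraph.subtract (h : HoldsGraph G m) (w : ℕ) (v : Fin n × Fin n × Fin n) :
    subtractMem n w v.1 v.2.1 v.2.2 m = increase w (fun x => ∃ q, Conflict G v q ∧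
      x = addr n 0 (tripleIdx n q.1 q.2.1 q.2.2)) m := by
  classical
  let R (a b c x : ℕ) : Prop := ∃ q : Fin n × Fin n × Fin n, (q.1 = a ∧ q.2.1 = b ∧ q.2.2 = c) ∧
    Conflict G v q ∧ x = addr n 0 (tripleIdx n q.1 q.2.1 q.2.2)
  have hR : ∀ {a b c a' b' c' x}, R a b c x → R a' b' c' x → a = a' ∧ b = b' ∧ c = c' := by
    rintro a b c a' b' c' x ⟨q, ⟨rfl, rfl, rfl⟩, -, hx⟩ ⟨q', ⟨rfl, rfl, rfl⟩, -, hx'⟩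
    rw [hx, addr_inj (by norm_num) (by norm_num), tripleIdx_inj] at hx'
    rw [hx'.2]
    exact ⟨rfl, rfl, rfl⟩
  let F (a b c : ℕ) (m : ℕ → ℕ) : ℕ → ℕ := if ConflictMem n m v.1 v.2.1 v.2.2 a b c then
    Function.update m (addr n 0 (tripleIdx n a b c)) (m (addr n 0 (tripleIdx n a b c)) + w) else m
  have body : ∀ a < n, ∀ b < n, ∀ c < n, ∀ m, HoldsGraph G m →
      F a b c m = increase w (R a b c) m ∧ HoldsGraph G (F a b c m) := by
    intro a ha b hb c hc m hm
    have hiff : ∀ x, R a b c x ↔ ConflictMem n m v.1 v.2.1 v.2.2 a b c ∧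
        x = addr n 0 (tripleIdx n a b c) := by
      intro x
      constructor
      · rintro ⟨q, ⟨rfl, rfl, rfl⟩, hq, hx⟩
        exact ⟨(hm.conflict v q).2 hq, hx⟩
      · rintro ⟨hq, hx⟩
        exact ⟨(⟨a, ha⟩, ⟨b, hb⟩, ⟨c, hc⟩), ⟨rfl, rfl, rfl⟩, (hm.conflict v _).1 hq, hx⟩
    refine ⟨?_, ?_⟩
    · funext x
      simp only [increase, hiff, F]
      by_cases h1 : ConflictMem n m v.1 v.2.1 v.2.2 a b c
      · by_cases h2 : x = addr n 0 (tripleIdx n a b c) <;> simp [h1, h2]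
      · simp [h1]
    · dsimp only [F]
      split_ifs
      · refine hm.congr fun x hx => Function.update_of_ne ?_ _ _
        unfold addr at hx ⊢
        omega
      · exact hm
  have := (forN_increase (n := n) (w := w) (f := fun a => forN n fun b => forN n (F a b)) (R := fun a x => ∃ b < n, ∃ c < n, R a b c x)
    (fun a ha m hm => forN_increase (n := n) (f := fun b => forN n (F a b)) (R := fun b x => ∃ c < n, R a b c x)
      (fun b hb m hm => forN_increase (n := n) (R := fun c x => R a b c x) (body a ha b hb)
        (fun c c' x h1 h2 => (hR h1 h2).2.2) hm)
      (by rintro b b' x ⟨_, _, h1⟩ ⟨_, _, h2⟩; exact (hR h1 h2).2.1) hm)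
    (by rintro a a' x ⟨_, _, _, _, h1⟩ ⟨_, _, _, _, h2⟩; exact (hR h1 h2).1) h).1
  refine Eq.trans (b := forN n (fun a => forN n fun b => forN n (F a b)) m) ?_ (this.trans ?_)
  · unfold subtractMem F
    congr!
  congr 1
  funext x
  rw [eq_iff_iff]
  constructor
  · rintro ⟨_, _, _, _, _, _, q, -, hq⟩
    exact ⟨q, hq⟩
  · rintro ⟨q, hq⟩
    exact ⟨q.1, q.1.2, q.2.1, q.2.1.2, q.2.2, q.2.2.2, q, ⟨rfl, rfl, rfl⟩, hq⟩

/-! ### The reduction phase: local ratio steps on the memory -/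

/-- The stack in the memory `m` holds `L`, whose head is on top. -/
def HoldsStack (n : ℕ) (m : ℕ → ℕ) : List (Fin n × Fin n × Fin n) → Prop
  | [] => True
  | v :: L => (m (addr n 3 L.length) = v.1 ∧ m (addr n 4 L.length) = v.2.1 ∧
      m (addr n 5 L.length) = v.2.2) ∧ HoldsStack n m L

theorem HoldsStack.congr {L : List (Fin n × Fin n × Fin n)} (h : HoldsStack n m L)
    (hm : ∀ x < L.length, m' (addr n 3 x) = m (addr n 3 x) ∧ m' (addr n 4 x) = m (addr n 4 x) ∧
      m' (addr n 5 x) = m (addr n 5 x)) : HoldsStack n m' L := by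
  induction L with
  | nil => trivial
  | cons v L ih =>
    obtain ⟨h1, h2, h3⟩ := hm L.length (by simp)
    refine ⟨by rw [h1, h2, h3]; exact h.1, ih h.2 fun x hx => hm x (hx.trans (by simp))⟩

/-- The paths of positive remaining weight. -/
noncomputable def alive (n : ℕ) (m : ℕ → ℕ) : Finset (Fin n × Fin n × Fin n) :=
  Finset.univ.filter fun p => 0 < rest n m p

/-- The state of the memory while weights are being reduced. -/
structure Reducing (G : SimpleGraph (Fin n)) (m : ℕ → ℕ) (L : List (Fin n × Fin n × Fin n)) :
    Prop where
  graph : HoldsGraph G m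
  flags : ∀ x, m (addr n 1 x) = 0
  out : m (addr n 2 1) = 0
  height : m (addr n 2 0) = L.length
  stack : HoldsStack n m L
  ratio : LocalRatio (Conflict G) (pathWeight G) (rest n m) L
  -- Each push exhausts a path; this bounds the height of the stack for `popAll`.
  card : L.length + (alive n m).card ≤ n * (n * n)

theorem pushMem_apply (n a b c : ℕ) (m : ℕ → ℕ) (x : ℕ) :
    pushMem n a b c m x = if x = addr n 2 0 then m (addr n 2 0) + 1 else
      if x = addr n 5 (m (addr n 2 0)) then c else if x = addr n 4 (m (addr n 2 0)) then b else
      if x = addr n 3 (m (addr n 2 0)) then a else m x := by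
  simp [pushMem, storeAt, Function.update_apply, addr_inj]

/-- A step either leaves the memory alone or performs one `LocalRatio.cons` and one push. In the
last clause `v` ends with no weight in both cases: if it was not processed although the
simpliciality condition holds, it had none before. -/
theorem Reducing.step {L : List (Fin n × Fin n × Fin n)} (h : Reducing G m L)
    (v : Fin n × Fin n × Fin n) :
    (∃ L', Reducing G (stepMem n v.1 v.2.1 v.2.2 m) L') ∧
    (∀ q, rest n (stepMem n v.1 v.2.1 v.2.2 m) q ≤ rest n m q) ∧
    ((∀ q q', 0 < rest n m q → 0 < rest n m q' → Conflict G v q → Conflict G v q' →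
      Conflict G q q') → rest n (stepMem n v.1 v.2.1 v.2.2 m) v = 0) := by
  classical
  rw [stepMem]
  split_ifs with hs
  swap
  · refine ⟨⟨L, h⟩, fun q => le_rfl, fun H => ?_⟩
    by_contra hv
    exact hs ((h.graph.simplicial v).2 ⟨Nat.pos_of_ne_zero hv, H⟩)
  obtain ⟨hv, hsimp⟩ := (h.graph.simplicial v).1 hs
  rw [show restMem n m v.1 v.2.1 v.2.2 = rest n m v from rfl, h.graph.subtract]
  set w := rest n m v with hw
  set m₁ : ℕ → ℕ := increase w (fun x => ∃ q, Conflict G v q ∧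
    x = addr n 0 (tripleIdx n q.1 q.2.1 q.2.2)) m with hm₁
  have h0 : ∀ q : Fin n × Fin n × Fin n, m₁ (addr n 0 (tripleIdx n q.1 q.2.1 q.2.2)) =
      m (addr n 0 (tripleIdx n q.1 q.2.1 q.2.2)) + if Conflict G v q then w else 0 := by
    intro q
    simp only [hm₁, increase, addr_inj (show 0 < 8 by norm_num) (show 0 < 8 by norm_num), true_and,
      tripleIdx_inj, exists_eq_right']
    split_ifs <;> rfl
  have hj : ∀ j x, 0 < j → j < 8 → m₁ (addr n j x) = m (addr n j x) := by
    intro j x hj0 hj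
    refine if_neg ?_
    rintro ⟨q, -, hq⟩
    rw [addr_inj hj (by norm_num)] at hq
    omega
  have hlow : ∀ x < addr n 0 0, m₁ x = m x := by
    intro x hx
    refine if_neg ?_
    rintro ⟨q, -, rfl⟩
    unfold addr at hx
    omega
  set m₂ := pushMem n v.1 v.2.1 v.2.2 m₁ with hm₂
  have hm₂_apply := pushMem_apply n v.1 v.2.1 v.2.2 m₁
  rw [hj 2 0 (by norm_num) (by norm_num), h.height, ← hm₂] at hm₂_apply
  have hgraph : HoldsGraph G m₂ := by
    refine h.graph.congr fun x hx => ?_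
    rw [hm₂_apply, if_neg, if_neg, if_neg, if_neg, hlow x hx] <;>
    · unfold addr at hx ⊢
      omega
  have hrest : rest n m₂ = fun q => rest n m q - if Conflict G v q then w else 0 := by
    funext q
    rw [hgraph.rest_eq, h.graph.rest_eq, hm₂_apply]
    simp only [addr_inj, Nat.reduceLT, OfNat.zero_ne_ofNat, false_and, if_false]
    rw [h0, Nat.sub_sub]
  have hle : ∀ q, rest n m₂ q ≤ rest n m q := fun q => by
    rw [hrest]
    exact Nat.sub_le _ _
  have hv0 : rest n m₂ v = 0 := by
    rw [hrest]
    beta_reduce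
    rw [if_pos (conflict_refl v), hw, Nat.sub_self]
  refine ⟨⟨v :: L, ⟨hgraph, fun x => ?_, ?_, ?_, ⟨?_, ?_⟩, ?_, ?_⟩⟩, hle, fun _ => hv0⟩
  · rw [hm₂_apply]
    simp only [addr_inj, Nat.reduceLT, OfNat.one_ne_ofNat, false_and, if_false]
    rw [hj 1 x (by norm_num) (by norm_num), h.flags]
  · rw [hm₂_apply]
    simp [addr_inj, hj, h.out]
  · rw [hm₂_apply]
    simp
  · simp [hm₂_apply, addr_inj]
  · refine h.stack.congr fun x hx => ?_
    simp [hm₂_apply, addr_inj, hx.ne, hj]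
  · rw [hrest]
    convert h.ratio.cons conflict_refl (fun _ _ => Conflict.symm) hv hsimp
  · have hlt : (alive n m₂).card < (alive n m).card := by
      refine Finset.card_lt_card (Finset.ssubset_iff_of_subset ?_ |>.2 ⟨v, ?_, ?_⟩)
      · intro q hq
        simp only [alive, Finset.mem_filter, Finset.mem_univ, true_and] at hq ⊢
        exact hq.trans_le (hle q)
      · simpa [alive] using hv
      · simp [alive, hv0]
    have := h.card
    rw [List.length_cons]
    omega

/-- Some `v` is simplicial among the paths alive at the start. Weights only decrease, so the
condition still holds when the sweep reaches `v`; its weight is then `0` and stays so. -/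
theorem Reducing.sweep {lo hi : Fin n → ℝ} (hG : IsIntervalModel G lo hi)
    {L : List (Fin n × Fin n × Fin n)} (h : Reducing G m L) :
    (∃ L', Reducing G (sweepMem n m) L') ∧
      (alive n (sweepMem n m)).card ≤ (alive n m).card - 1 := by
  let I (m' : ℕ → ℕ) : Prop := (∃ L', Reducing G m' L') ∧ ∀ q, rest n m' q ≤ rest n m q
  have hI : ∀ a < n, ∀ b < n, ∀ c < n, ∀ m', I m' → I (stepMem n a b c m') := by
    rintro a ha b hb c hc m' ⟨⟨L', h'⟩, hle⟩
    obtain ⟨h1, h2, -⟩ := h'.step (⟨a, ha⟩, ⟨b, hb⟩, ⟨c, hc⟩)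
    exact ⟨h1, fun q => (h2 q).trans (hle q)⟩
  have hI₂ := fun a ha b hb m' => forN_preserve (m := m') (hI a ha b hb)
  have hI₁ := fun a ha m' => forN_preserve (m := m') (hI₂ a ha)
  have h0 : I m := ⟨⟨L, h⟩, fun _ => le_rfl⟩
  obtain ⟨hL', hle⟩ : I (sweepMem n m) := forN_preserve hI₁ h0
  refine ⟨hL', ?_⟩
  rcases (alive n m).eq_empty_or_nonempty with he | hne
  · rw [he]
    have : alive n (sweepMem n m) ⊆ alive n m := by
      intro q hq
      simp only [alive, Finset.mem_filter, Finset.mem_univ, true_and] at hq ⊢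
      exact hq.trans_le (hle q)
    rw [he, Finset.subset_empty] at this
    simp [this]
  have hpos : ∀ p ∈ alive n m, 0 < pathWeight G p := by
    intro p hp
    simp only [alive, Finset.mem_filter, Finset.mem_univ, true_and, h.graph.rest_eq] at hp
    omega
  obtain ⟨v, hv, hsimp⟩ := hG.exists_simplicial hne hpos
  simp only [alive, Finset.mem_filter, Finset.mem_univ, true_and] at hv hsimp
  let Q (m' : ℕ → ℕ) : Prop := I m' ∧ rest n m' v = 0
  have hQ : ∀ a < n, ∀ b < n, ∀ c < n, ∀ m', Q m' → Q (stepMem n a b c m') := by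
    rintro a ha b hb c hc m' ⟨hm', hv⟩
    obtain ⟨L', h'⟩ := hm'.1
    obtain ⟨h1, h2, -⟩ := h'.step (⟨a, ha⟩, ⟨b, hb⟩, ⟨c, hc⟩)
    exact ⟨hI a ha b hb c hc m' hm', Nat.le_zero.1 (hv ▸ h2 v)⟩
  have hQ₂ := fun a ha b hb m' => forN_preserve (m := m') (hQ a ha b hb)
  have hQ₁ := fun a ha m' => forN_preserve (m := m') (hQ₂ a ha)
  have hreach : ∀ m', I m' → Q (stepMem n v.1 v.2.1 v.2.2 m') := by
    intro m' hm'
    refine ⟨hI v.1 v.1.2 v.2.1 v.2.1.2 v.2.2 v.2.2.2 m' hm', ?_⟩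
    obtain ⟨⟨L', h'⟩, hle⟩ := hm'
    exact (h'.step v).2.2 fun q q' hq hq' => hsimp q (hq.trans_le (hle q)) q' (hq'.trans_le (hle q'))
  have hv0 : Q (sweepMem n m) :=
    forN_reach v.1.2 hI₁ (fun a ha m' _ => hQ₁ a ha m')
      (fun m' hm' => forN_reach v.2.1.2 (hI₂ v.1 v.1.2) (fun b hb m' _ => hQ₂ v.1 v.1.2 b hb m')
        (fun m' hm' => forN_reach v.2.2.2 (hI v.1 v.1.2 v.2.1 v.2.1.2)
          (fun c hc m' _ => hQ v.1 v.1.2 v.2.1 v.2.1.2 c hc m') hreach hm') hm') h0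
  have hlt : (alive n (sweepMem n m)).card < (alive n m).card := by
    refine Finset.card_lt_card (Finset.ssubset_iff_of_subset ?_ |>.2 ⟨v, ?_, ?_⟩)
    · intro q hq
      simp only [alive, Finset.mem_filter, Finset.mem_univ, true_and] at hq ⊢
      exact hq.trans_le (hle q)
    · simpa [alive] using hv
    · simp [alive, hv0.2]
  omega

theorem Reducing.reduceAll {lo hi : Fin n → ℝ} (hG : IsIntervalModel G lo hi)
    {L : List (Fin n × Fin n × Fin n)} (h : Reducing G m L) :
    ∃ L', Reducing G (reduceAll n m) L' ∧ ∀ p, rest n (EdgeOpenPacking.reduceAll n m) p = 0 := by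
  let K (t : ℕ) (m : ℕ → ℕ) : Prop := (∃ L, Reducing G m L) ∧ (alive n m).card ≤ n * (n * n) - t
  have hK : ∀ t m, K t m → K (t + 1) (sweepMem n m) := by
    rintro t m ⟨⟨L, h⟩, hc⟩
    obtain ⟨h1, h2⟩ := h.sweep hG
    exact ⟨h1, by omega⟩
  have h0 : K 0 m := ⟨⟨L, h⟩, by have := h.card; omega⟩
  -- Each of the three nested loops contributes a factor `n` to the number of sweeps.
  obtain ⟨⟨L', h'⟩, hc⟩ : K (0 + n * (n * (n * 1))) (EdgeOpenPacking.reduceAll n m) :=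
    forN_count (fun _ _ t m hm => forN_count (fun _ _ t m hm => forN_count
      (fun _ _ t m hm => hK t m hm) hm) hm) h0
  refine ⟨L', h', fun p => ?_⟩
  rw [zero_add, mul_one, Nat.sub_self, Nat.le_zero, Finset.card_eq_zero] at hc
  have : p ∉ alive n (EdgeOpenPacking.reduceAll n m) := by simp [hc]
  simpa [alive] using this

/-! ### The selection phase: unwinding the stack -/

/-- The state of the memory while paths are being chosen: `S` has been chosen, and `L` is left. -/
structure Choosing (G : SimpleGraph (Fin n)) (m : ℕ → ℕ) (S : Finset (Fin n × Fin n × Fin n))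
    (L : List (Fin n × Fin n × Fin n)) : Prop where
  graph : HoldsGraph G m
  flags : ∀ x y : Fin n, 0 < m (addr n 1 (pairIdx n x y)) ↔
    ∃ q ∈ S, (x = q.1 ∨ x = q.2.2) ∧ y = q.2.1
  out : m (addr n 2 1) = 0
  height : m (addr n 2 0) = L.length
  stack : HoldsStack n m L

/-- The chosen paths need not be stored as triples: their vertices are exactly the endpoints of the
flagged edges, and a conflict depends only on vertices. -/
theorem Choosing.blocked {S : Finset (Fin n × Fin n × Fin n)} {L : List (Fin n × Fin n × Fin n)}
    (h : Choosing G m S L) (v : Fin n × Fin n × Fin n) :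
    BlockedMem n m v.1 v.2.1 v.2.2 ↔ ∃ q ∈ S, Conflict G v q := by
  have hsymm : ∀ q, Conflict G v q ↔ Conflict G q v := fun q => ⟨.symm, .symm⟩
  constructor
  · rintro ⟨x, hx, y, hy, hf, ht⟩
    obtain ⟨q, hq, hxq, hyq⟩ := (h.flags ⟨x, hx⟩ ⟨y, hy⟩).1 hf
    refine ⟨q, hq, (hsymm q).2 ?_⟩
    rcases ht with ht | ht
    · have ht := (h.graph.touches ⟨x, hx⟩ v).1 ht
      rcases hxq with hxq | hxq <;> rw [hxq] at ht
      exacts [.inl ht, .inr (.inr ht)]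
    · have ht := (h.graph.touches ⟨y, hy⟩ v).1 ht
      rw [hyq] at ht
      exact .inr (.inl ht)
  · rintro ⟨q, hq, hvq⟩
    rcases (hsymm q).1 hvq with ht | ht | ht
    · exact ⟨q.1, q.1.2, q.2.1, q.2.1.2, (h.flags _ _).2 ⟨q, hq, .inl rfl, rfl⟩,
        .inl ((h.graph.touches _ v).2 ht)⟩
    · exact ⟨q.1, q.1.2, q.2.1, q.2.1.2, (h.flags _ _).2 ⟨q, hq, .inl rfl, rfl⟩,
        .inr ((h.graph.touches _ v).2 ht)⟩
    · exact ⟨q.2.2, q.2.2.2, q.2.1, q.2.1.2, (h.flags _ _).2 ⟨q, hq, .inr rfl, rfl⟩,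
        .inl ((h.graph.touches _ v).2 ht)⟩

/-- One pop carries out one step of `complete`, so the final result is an invariant of the phase. -/
theorem Choosing.pop {S : Finset (Fin n × Fin n × Fin n)} {L : List (Fin n × Fin n × Fin n)}
    (h : Choosing G m S L) :
    ∃ S', Choosing G (popMem n m) S' L.tail ∧
      complete (Conflict G) S' L.tail = complete (Conflict G) S L := by
  rw [popMem, h.height]
  cases L with
  | nil => exact ⟨S, by simpa using h, rfl⟩
  | cons v L =>
    rw [if_pos (by simp), List.tail_cons]
    set m₁ := storeAt (fun _ => addr n 2 0) (fun m => m (addr n 2 0) - 1) m with hm₁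
    have hm₁_apply : ∀ x, m₁ x = if x = addr n 2 0 then L.length else m x := by
      intro x
      rw [hm₁, storeAt, Function.update_apply, h.height]
      simp
    have h₁ : Choosing G m₁ S L := by
      refine ⟨h.graph.congr fun x hx => ?_, fun x y => ?_, ?_, ?_, h.stack.2.congr fun x hx => ?_⟩
      · rw [hm₁_apply, if_neg]
        unfold addr at hx ⊢
        omega
      · rw [← h.flags, hm₁_apply]
        simp [addr_inj]
      · simp [hm₁_apply, addr_inj, h.out]
      · rw [hm₁_apply, if_pos rfl]
      · simp [hm₁_apply, addr_inj]
    have htop : m₁ (addr n 3 L.length) = v.1 ∧ m₁ (addr n 4 L.length) = v.2.1 ∧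
        m₁ (addr n 5 L.length) = v.2.2 := by
      simpa [hm₁_apply, addr_inj] using h.stack.1
    rw [takeMem, h₁.height, htop.1, htop.2.1, htop.2.2, chooseMem, complete]
    refine ⟨_, ?_, rfl⟩
    rw [h₁.blocked v]
    split_ifs with hc
    · exact h₁
    set m₂ := storeAt (fun _ => addr n 1 (pairIdx n v.2.2 v.2.1)) (fun _ => 1)
      (storeAt (fun _ => addr n 1 (pairIdx n v.1 v.2.1)) (fun _ => 1) m₁) with hm₂
    have hm₂_apply : ∀ x, m₂ x = if x = addr n 1 (pairIdx n v.2.2 v.2.1) then 1 else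
        if x = addr n 1 (pairIdx n v.1 v.2.1) then 1 else m₁ x := by
      intro x
      rw [hm₂, storeAt, storeAt, Function.update_apply, Function.update_apply]
    refine ⟨h₁.graph.congr fun x hx => ?_, fun x y => ?_, ?_, ?_, h₁.stack.congr fun x hx => ?_⟩
    · rw [hm₂_apply, if_neg, if_neg] <;>
      · unfold addr at hx ⊢
        omega
    · rw [hm₂_apply]
      simp only [Finset.mem_insert, exists_eq_or_imp]
      rw [← h₁.flags]
      simp only [addr_inj (show 1 < 8 by norm_num) (show 1 < 8 by norm_num), true_and,
        pairIdx_inj y.2 v.2.1.2, ← Fin.ext_iff]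
      split_ifs with h1 h2
      · exact iff_of_true one_pos (.inl ⟨.inr h1.1, h1.2⟩)
      · exact iff_of_true one_pos (.inl ⟨.inl h2.1, h2.2⟩)
      · exact ⟨.inr, fun h => h.resolve_left fun ⟨h3, h4⟩ =>
          h3.elim (fun h5 => h2 ⟨h5, h4⟩) fun h5 => h1 ⟨h5, h4⟩⟩
    · rw [hm₂_apply, ← h₁.out]
      simp [addr_inj]
    · rw [hm₂_apply, ← h₁.height]
      simp [addr_inj]
    · simp [hm₂_apply, addr_inj]

theorem Choosing.popAll {S : Finset (Fin n × Fin n × Fin n)} {L : List (Fin n × Fin n × Fin n)}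
    (h : Choosing G m S L) (hL : L.length ≤ n * (n * n)) :
    Choosing G (popAll n m) (complete (Conflict G) S L) [] := by
  let K (t : ℕ) (m : ℕ → ℕ) : Prop := ∃ S' L', Choosing G m S' L' ∧
    L'.length ≤ n * (n * n) - t ∧ complete (Conflict G) S' L' = complete (Conflict G) S L
  have hK : ∀ t m, K t m → K (t + 1) (popMem n m) := by
    rintro t m ⟨S', L', h', hl, hc⟩
    obtain ⟨S'', h'', hc'⟩ := h'.pop
    exact ⟨S'', L'.tail, h'', by rw [List.length_tail]; omega, hc'.trans hc⟩
  have h0 : K 0 m := ⟨S, L, h, hL, rfl⟩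
  obtain ⟨S', L', h', hl, hc⟩ : K (0 + n * (n * (n * 1))) (EdgeOpenPacking.popAll n m) :=
    forN_count (fun _ _ t m hm => forN_count (fun _ _ t m hm => forN_count
      (fun _ _ t m hm => hK t m hm) hm) hm) h0
  rw [zero_add, mul_one, Nat.sub_self, Nat.le_zero, List.length_eq_zero_iff] at hl
  subst hl
  rw [← hc]
  exact h'

/-! ### The output phase -/

/-- The state of the memory while edges are being written: those at positions before `t` have been
written. -/
structure Emitting (D : Finset (Sym2 (Fin n))) (t : ℕ) (m : ℕ → ℕ) (L : List (Fin n × Fin n)) :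
    Prop where
  flags : ∀ x y : Fin n, 0 < m (addr n 1 (pairIdx n x y)) ∨ 0 < m (addr n 1 (pairIdx n y x)) ↔
    s(x, y) ∈ D
  length_le : L.length ≤ t
  length_eq : m (addr n 2 1) = 2 * L.length
  out : (List.range (2 * L.length)).map m = L.flatMap fun e => [(e.1 : ℕ), (e.2 : ℕ)]
  nodup : L.Nodup
  mem_iff : ∀ e, e ∈ L ↔ (e.1 < e.2 ∧ s(e.1, e.2) ∈ D) ∧ pairIdx n e.1 e.2 < t

/-- Pairs are scanned in the order of `pairIdx`, with at most one edge written per position. The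
output overwrites the adjacency matrix, so the invariant speaks only of the flags and the output. -/
theorem Emitting.emit {D : Finset (Sym2 (Fin n))} {L : List (Fin n × Fin n)} (x y : Fin n)
    (h : Emitting D (pairIdx n x y) m L) :
    ∃ L', Emitting D (pairIdx n x y + 1) (emitMem n x y m) L' := by
  have hmem : ∀ e : Fin n × Fin n, pairIdx n e.1 e.2 < pairIdx n x y + 1 ↔
      pairIdx n e.1 e.2 < pairIdx n x y ∨ e = (x, y) := by
    intro e
    rw [Nat.lt_succ_iff_lt_or_eq, pairIdx_inj e.2.2 y.2, Prod.ext_iff, Fin.ext_iff, Fin.ext_iff]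
  rw [emitMem, EdgeMem, h.flags, ← Fin.lt_def]
  split_ifs with hxy
  · set m₁ := storeAt (fun _ => addr n 2 1) (fun m => m (addr n 2 1) + 2)
      (storeAt (fun m => m (addr n 2 1) + 1) (fun _ => (y : ℕ))
        (storeAt (fun m => m (addr n 2 1)) (fun _ => (x : ℕ)) m)) with hm₁
    -- The arrays start beyond `2 * n ^ 2` for this reason: fewer than `n ^ 2` edges precede, and
    -- each takes two cells.
    have hlt : 2 * L.length + 1 < addr n 0 0 := by
      have := h.length_le
      have := pairIdx_lt x.2 y.2
      unfold addr
      omega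
    have hne : ∀ j x, 2 * L.length ≠ addr n j x ∧ 2 * L.length + 1 ≠ addr n j x := by
      intro j x
      unfold addr at hlt ⊢
      omega
    have hm₁_apply : ∀ z, m₁ z = if z = addr n 2 1 then 2 * L.length + 2 else
        if z = 2 * L.length + 1 then (y : ℕ) else if z = 2 * L.length then (x : ℕ) else m z := by
      intro z
      simp [hm₁, storeAt, Function.update_apply, h.length_eq, (hne _ _).1.symm, (hne _ _).2.symm]
    refine ⟨L ++ [(x, y)], ⟨fun a b => ?_, ?_, ?_, ?_, ?_, fun e => ?_⟩⟩
    · rw [← h.flags]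
      simp [hm₁_apply, addr_inj, (hne _ _).1.symm, (hne _ _).2.symm]
    · simpa using h.length_le
    · rw [hm₁_apply, if_pos rfl, List.length_append, List.length_singleton, mul_add]
    · have hout : (List.range (2 * L.length)).map m₁ = (List.range (2 * L.length)).map m := by
        refine List.map_congr_left fun z hz => ?_
        rw [List.mem_range] at hz
        rw [hm₁_apply, if_neg, if_neg, if_neg] <;> unfold addr at * <;> omega
      rw [List.length_append, List.length_singleton, mul_add, mul_one, List.range_succ,
        List.range_succ, List.map_append, List.map_append, hout, h.out, List.flatMap_append]
      simp [hm₁_apply, hne]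
    · refine List.Nodup.append h.nodup (by simp) ?_
      simp [h.mem_iff]
    · rw [List.mem_append, h.mem_iff, hmem, List.mem_singleton]
      constructor
      · rintro (he | rfl)
        exacts [⟨he.1, .inl he.2⟩, ⟨hxy, .inr rfl⟩]
      · tauto
  · refine ⟨L, ⟨h.flags, h.length_le.trans (Nat.le_succ _), h.length_eq, h.out, h.nodup,
      fun e => ?_⟩⟩
    rw [h.mem_iff, hmem]
    constructor
    · tauto
    · rintro ⟨he, he' | rfl⟩
      exacts [⟨he, he'⟩, absurd he hxy]

theorem Emitting.emitAll {D : Finset (Sym2 (Fin n))} (h : Emitting D 0 m []) :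
    ∃ L, Emitting D (n * n) (emitAll n m) L := by
  refine forN_induct (I := fun k m => ∃ L, Emitting D (k * n) m L) (fun x hx m hm => ?_)
    ⟨[], by simpa using h⟩
  have := forN_induct (n := n) (f := fun y => emitMem n x y)
    (I := fun k m => ∃ L, Emitting D (x * n + k) m L)
    (fun y hy m hm => by
      obtain ⟨L, hL⟩ := hm
      exact hL.emit ⟨x, hx⟩ ⟨y, hy⟩) (m := m) (by simpa using hm)
  rwa [Nat.succ_mul]

/-- Each edge is listed with its smaller endpoint first, so distinct pairs are distinct edges. -/
theorem Emitting.listsEdges {D : Finset (Sym2 (Fin n))} {L : List (Fin n × Fin n)} {G}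
    (hD : IsEOP G D) (h : Emitting D (n * n) m L) :
    ListsEdges (L.flatMap fun e => [(e.1 : ℕ), (e.2 : ℕ)]) D := by
  refine ⟨L, rfl, h.nodup.map_on ?_, fun e => ?_⟩
  · rintro ⟨a, b⟩ ha ⟨c, d⟩ hc heq
    have ha := ((h.mem_iff _).1 ha).1.1
    have hc := ((h.mem_iff _).1 hc).1.1
    dsimp only at ha hc heq
    rcases Sym2.eq_iff.1 heq with ⟨rfl, rfl⟩ | ⟨rfl, rfl⟩
    exacts [rfl, absurd ha hc.not_gt]
  · rw [List.mem_map]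
    constructor
    · intro he
      induction e with
      | h a b =>
        rcases lt_or_gt_of_ne (G.ne_of_adj (hD.1 he)) with hab | hab
        · exact ⟨(a, b), (h.mem_iff _).2 ⟨⟨hab, he⟩, pairIdx_lt a.2 b.2⟩, rfl⟩
        · exact ⟨(b, a), (h.mem_iff _).2 ⟨⟨hab, Sym2.eq_swap ▸ he⟩, pairIdx_lt b.2 a.2⟩,
            Sym2.eq_swap⟩
    · rintro ⟨e, he, rfl⟩
      exact ((h.mem_iff e).1 he).1.2

/-! ### The whole algorithm on an encoded graph -/

theorem encodeGraph_getD (G : SimpleGraph (Fin n)) :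
    HoldsGraph G (fun i => (encodeGraph G).getD i 0) ∧
      ∀ j x, (encodeGraph G).getD (addr n j x) 0 = 0 := by
  constructor
  · intro a b
    have hlt := pairIdx_lt a.2 b.2
    have hn : 0 < n := a.pos
    rw [AdjMem, encodeGraph, add_comm 1, List.getD_cons_succ,
      List.getD_eq_getElem _ _ (by simpa using hlt), List.getElem_ofFn]
    have h1 : Fin.divNat (⟨pairIdx n a b, hlt⟩ : Fin (n * n)) = a := by
      ext
      simp [Fin.divNat, pairIdx, mul_comm (a : ℕ), Nat.mul_add_div hn]
    have h2 : Fin.modNat (⟨pairIdx n a b, hlt⟩ : Fin (n * n)) = b := by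
      ext
      simp [Fin.modNat, pairIdx, Nat.mod_eq_of_lt b.2]
    rw [h1, h2]
    split_ifs with h <;> simp [h]
  · intro j x
    refine List.getD_eq_default _ _ ?_
    rw [encodeGraph, List.length_cons, List.length_ofFn]
    unfold addr
    omega

/-- With the arrays zero at the start, the residual weights are `pathWeight G`. The local ratio
optimum then beats every independent set of paths, hence every packing by `IsEOP.exists_indep`. -/
theorem exists_output {n : ℕ} (G : SimpleGraph (Fin n)) (hG : IsProperIntervalGraph G)
    (m : ℕ → ℕ) (hm : HoldsGraph G m) (h0 : ∀ j x, m (addr n j x) = 0) :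
    ∃ (y : List ℕ) (D : Finset (Sym2 (Fin n))),
      emitAll n (popAll n (reduceAll n m)) (addr n 2 1) = y.length ∧
      (∀ (i : ℕ) (h : i < y.length), emitAll n (popAll n (reduceAll n m)) i = y[i]) ∧
      ListsEdges y D ∧ IsMaximumEOP G D := by
  obtain ⟨lo, hi, hmodel, -⟩ := hG.exists_model
  have hrest : rest n m = pathWeight G := funext fun p => by rw [hm.rest_eq, h0, Nat.sub_zero]
  have hred : Reducing G m [] := by
    refine ⟨hm, fun _ => h0 _ _, h0 _ _, h0 _ _, trivial, hrest ▸ LocalRatio.nil, ?_⟩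
    simpa using (alive n m).card_le_univ
  obtain ⟨L, hL, hzero⟩ := hred.reduceAll hmodel
  obtain ⟨hindep, hpos, hopt⟩ := hL.ratio.optimal hzero
  have hchoose : Choosing G (reduceAll n m) ∅ L :=
    ⟨hL.graph, fun x y => by simp [hL.flags], hL.out, hL.height, hL.stack⟩
  have hchosen := hchoose.popAll ((Nat.le_add_right _ _).trans hL.card)
  set S := complete (Conflict G) ∅ L
  obtain ⟨hEOP, hcard⟩ := hindep.isEOP hpos
  have hemit : Emitting (S.biUnion pathEdges) 0 (popAll n (reduceAll n m)) [] := by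
    refine ⟨fun x y => ?_, le_rfl, hchosen.out, rfl, .nil, by simp⟩
    rw [hchosen.flags, hchosen.flags, Finset.mem_biUnion, ← exists_or]
    refine exists_congr fun q => ?_
    simp only [pathEdges, Finset.mem_insert, Finset.mem_singleton, Sym2.eq_iff]
    tauto
  obtain ⟨K, hK⟩ := hemit.emitAll
  have hlen : (K.flatMap fun e => [(e.1 : ℕ), (e.2 : ℕ)]).length = 2 * K.length := by
    rw [← hK.out, List.length_map, List.length_range]
  refine ⟨_, _, hK.length_eq.trans hlen.symm, fun i hi => ?_, hK.listsEdges hEOP, hEOP,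
    fun D' hD' => ?_⟩
  · simp only [← hK.out, List.getElem_map, List.getElem_range]
  · obtain ⟨I, hI, -, hc⟩ := hD'.exists_indep hG
    rw [hc, hcard]
    exact hopt I hI

end

/-- A maximum edge open packing of a proper interval graph is computed in polynomial time. -/
theorem exists_polynomial_time_program :
    ∃ (P : RAM.Prog) (p : Polynomial ℕ),
      ∀ (n : ℕ) (G : SimpleGraph (Fin n)), IsProperIntervalGraph G →
        ∃ (y : List ℕ) (t : ℕ) (D : Finset (Sym2 (Fin n))),
          RAM.OutputsIn P (encodeGraph G) y t ∧ t ≤ p.eval (encodeGraph G).length ∧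
          ListsEdges y D ∧ IsMaximumEOP G D := by
  obtain ⟨P, p, hP⟩ := exists_prog comp_main comp_outputLength
  refine ⟨P, p, fun n G hG => ?_⟩
  obtain ⟨hgraph, hzero⟩ := encodeGraph_getD G
  obtain ⟨y, D, hlen, hout, hlist, hmax⟩ := exists_output G hG _ hgraph hzero
  obtain ⟨t, ht, hle⟩ := hP n (encodeGraph G) y (by simp [encodeGraph])
    (by
      rw [encodeGraph, List.length_cons, List.length_ofFn]
      exact (Nat.le_mul_self n).trans (Nat.le_succ _)) hlen hout
  exact ⟨y, t, D, ht, hle, hlist, hmax⟩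

end EdgeOpenPacking

theorem mainTheorem1 :
    (∃ (P : RAM.Prog) (p : Polynomial ℕ),
      ∀ (n : ℕ) (G : SimpleGraph (Fin n)), EdgeOpenPacking.IsProperIntervalGraph G →
        ∃ (y : List ℕ) (t : ℕ) (D : Finset (Sym2 (Fin n))),
          RAM.OutputsIn P (EdgeOpenPacking.encodeGraph G) y t ∧
          t ≤ p.eval (EdgeOpenPacking.encodeGraph G).length ∧
          EdgeOpenPacking.ListsEdges y D ∧
          EdgeOpenPacking.IsMaximumEOP G D) ∧
    (∀ (V : Type*) [Finite V] (n : ℕ) (G : SimpleGraph V) (σ : Fin (n + 1) ≃ V),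
      G.Connected → EdgeOpenPacking.IsProperIntervalGraph G → EdgeOpenPacking.IsBCO G σ →
        IsGreatest
          ({m : ℕ | ∃ j : Fin (n + 1), 0 < j ∧ j ≤ EdgeOpenPacking.lastNbr G σ 0 ∧
              m = 1 + EdgeOpenPacking.eopNumber
                (EdgeOpenPacking.suffixAfter G σ (EdgeOpenPacking.lastNbr G σ j))} ∪
           {m : ℕ | ∃ j p : Fin (n + 1), 0 < j ∧ j ≤ EdgeOpenPacking.lastNbr G σ 0 ∧
              EdgeOpenPacking.lastNbr G σ 0 < p ∧ p ≤ EdgeOpenPacking.lastNbr G σ j ∧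
              m = 2 + EdgeOpenPacking.eopNumber
                (EdgeOpenPacking.suffixAfter G σ (EdgeOpenPacking.lastNbr G σ p))} ∪
           {EdgeOpenPacking.eopNumber (EdgeOpenPacking.suffixAfter G σ 0)})
          (EdgeOpenPacking.eopNumber G)) :=
  ⟨EdgeOpenPacking.exists_polynomial_time_program,
    fun _ _ _ _ _ hG _ hσ => hσ.eopNumber_isGreatest hG⟩
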